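/- **Setting.** All algorithms are uniform (one program for all input sizes) and are either classical randomized or quantum; the statement holds for each of these two kinds separately. "Kind" below means the same fixed kind (classical or quantum) throughout. *Local quantum circuits.* For $n,d\in\mathbb N$ let $\mathcal D(n,d)$ be the set of all probability distributions on $\{0,1\}^n$ of the form $P(x)=|\langle x|U|0^n\rangle|^2$, where $U$ is implemented by a one-dimensional nearest-neighbour circuit on $n$ qubits with $d$ layers, each layer consisting of arbitrary one-qubit unitaries and arbitrary two-qubit unitaries on neighbouring qubits, acting on pairwise disjoint sets of qubits (qubits may be idle). *Evaluator learning.* A family $(\mathcal D_n)_n$ of sets of distributions on $\{0,1\}^n$ is *efficiently learnable with respect to an evaluator* if there is an algorithm which, for all $n$, all $P\in\mathcal D_n$ and all $\varepsilon,\delta\in(0,1)$, given $n$, $\lceil 1/\varepsilon\rceil$, $\lceil 1/\delta\rceil$ in unary and access to independent samples from $P$, with probability at least $1-\delta$ outputs within $\mathrm{poly}(n,1/\varepsilon,1/\delta)$ steps an efficient evaluator of a probability distribution $Q$ on $\{0,1\}^n$ with $\mathrm{TV}(P,Q)=\frac12\sum_x|P(x)-Q(x)|<\varepsilon$. Here an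 efficient evaluator of $Q$ is a string describing (for a fixed deterministic interpreter) a deterministic algorithm that, on input $x\in\{0,1\}^n$ and a precision $m$ in unary, computes the number $Q(x)$ up to an error of at most $2^{-m}$ in time $\mathrm{poly}(n,1/\varepsilon,1/\delta,m)$. *LPN assumption at noise rate $\eta$.* For $s\in\{0,1\}^k$ a noisy example of the parity function $\chi_s(x)=\sum_i s_ix_i \bmod 2$ is a pair $(x,y)$ with $x$ uniform in $\{0,1\}^k$ and $y=\chi_s(x)$ with probability $1-\eta$, $y=1-\chi_s(x)$ with probability $\eta$. The assumption is that there is no algorithm which, for all $k$, $s\in\{0,1\}^k$ and $\varepsilon,\delta\in(0,1)$, given $k$, $\lceil 1/\varepsilon\rceil$, $\lceil 1/\delta\rceil$ in unary and access to independent noisy examples of $\chi_s$, with probability at least $1-\delta$ outputs within $\mathrm{poly}(k,1/\varepsilon,1/\delta)$ steps a description (for a fixed deterministic interpreter) of a hypothesis $h:\{0,1\}^k\to\{0,1\}$, computable in time $\mathrm{poly}(k,1/\varepsilon,1/\delta)$, with $\Pr_x[h(x)\neq\chi_s(x)]<\varepsilon$ for uniform $x$. **Corollary.** Suppose that the LPN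 assumption holds, for algorithms of the given kind, at some constant noise rate $\eta\in(0,1/2)$. Let $d:\mathbb N\to\mathbb N$ satisfy $d(n)=n^{\Omega(1)}$, i.e. there is $c>0$ with $d(n)\ge n^c$ for all sufficiently large $n$. Then the family $(\mathcal D(n,d(n)))_n$ of output distributions of local quantum circuits of depth $d(n)$ is not efficiently learnable with respect to an evaluator by algorithms of that kind. -/

import Mathlib

noncomputable section

namespace CircuitLearning

/-! ## Local quantum circuits and their output distributions -/

/-- Bit strings of length `n`, i.e. labels of the computational basis of `n` qubits. -/
abbrev Bits (n : ℕ) := Fin n → Bool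

/-- A gate placed on a line of `n` qubits: an arbitrary one-qubit unitary, or an arbitrary
two-qubit unitary acting on two neighbouring qubits `i` and `j = i + 1`. -/
inductive Gate (n : ℕ) where
  | one (i : Fin n) (u : Matrix.unitaryGroup Bool ℂ)
  | two (i j : Fin n) (hij : (j : ℕ) = i + 1) (u : Matrix.unitaryGroup (Bool × Bool) ℂ)

/-- The qubits that a gate acts on. -/
def Gate.support {n : ℕ} : Gate n → Finset (Fin n)
  | .one i _ => {i}
  | .two i j _ _ => {i, j}

/-- The action of a gate on a state vector `ψ`, given by its amplitudes `ψ x = ⟨x|ψ⟩`. -/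
def Gate.apply {n : ℕ} (g : Gate n) (ψ : Bits n → ℂ) : Bits n → ℂ :=
  match g with
  | .one i u => fun x => ∑ b : Bool, u.1 (x i) b * ψ (Function.update x i b)
  | .two i j _ u => fun x => ∑ b : Bool × Bool,
      u.1 (x i, x j) b * ψ (Function.update (Function.update x i b.1) j b.2)

/-- A layer: gates acting on pairwise disjoint sets of qubits. -/
def Layer (n : ℕ) : Type :=
  {L : List (Gate n) // L.Pairwise fun g h => Disjoint g.support h.support}

/-- The state obtained from `ψ` by applying the gates of a layer. -/
def Layer.apply {n : ℕ} (L : Layer n) (ψ : Bits n → ℂ) : Bits n → ℂ :=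
  L.1.foldl (fun φ g => g.apply φ) ψ

/-- A one-dimensional nearest-neighbour ("local") circuit of depth `d` on `n` qubits:
a sequence of `d` layers, the first one being applied first. -/
def LocalCircuit (n d : ℕ) : Type := {C : List (Layer n) // C.length = d}

/-- The state `U |0ⁿ⟩`, where `U` is the unitary of the circuit. -/
def LocalCircuit.outputState {n d : ℕ} (C : LocalCircuit n d) : Bits n → ℂ :=
  C.1.foldl (fun φ L => L.apply φ) (fun x => if x = fun _ => false then 1 else 0)

/-- The class of output distributions `P(x) = |⟨x|U|0ⁿ⟩|²` of local circuits of depth `d`. -/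
def circuitDistributions (n d : ℕ) : Set (Bits n → ℝ) :=
  {P | P ∈ stdSimplex ℝ (Bits n) ∧ ∃ C : LocalCircuit n d, ∀ x, P x = ‖C.outputState x‖ ^ 2}

/-- The total variation distance. -/
def tvDist {n : ℕ} (P Q : Bits n → ℝ) : ℝ := 1 / 2 * ∑ x, |P x - Q x|

/-! ## Algorithms

Algorithms are programs for a machine with finitely many stacks of bits (stacks are numbered by
`ℕ`, a program mentions only finitely many of them). Such a machine is, up to polynomial overhead,
a multi-tape Turing machine. It can in addition toss coins, draw samples from an oracle, and
operate on a tape of qubits (numbered by `ℕ`) through two movable heads, with the gates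
Hadamard, T and CNOT and with measurements, whose results are available to the classical control.
Every step of the machine has unit cost. -/

/-- Programs. -/
inductive Program where
  /-- do nothing -/
  | skip
  /-- sequential composition -/
  | seq (p q : Program)
  /-- push the bit `b` onto stack `i` -/
  | push (i : ℕ) (b : Bool)
  /-- remove the top bit of stack `i` (no effect on an empty stack) -/
  | pop (i : ℕ)
  /-- continue with `p`, `q` or `r` if stack `i` is empty, has top bit 0, or has top bit 1 -/
  | cases (i : ℕ) (p q r : Program)
  /-- repeat `p` as long as stack `i` is non-empty -/
  | loop (i : ℕ) (p : Program)
  /-- push a uniformly random bit onto stack `i` -/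
  | coin (i : ℕ)
  /-- replace the content of stack `i` by a fresh sample from the oracle, first bit on top -/
  | sample (i : ℕ)
  /-- move the first (`false`) or second (`true`) qubit head one position to the right -/
  | moveRight (h : Bool)
  /-- move a qubit head one position to the left (no effect at position 0) -/
  | moveLeft (h : Bool)
  /-- apply a Hadamard gate to the qubit at the first head -/
  | hadamard
  /-- apply a T gate to the qubit at the first head -/
  | tgate
  /-- apply a CNOT with control at the first head and target at the second head
  (no effect if both heads are at the same position) -/
  | cnot
  /-- measure the qubit at the first head and push the result onto stack `i` -/
  | measure (i : ℕ)

/-- Programs without quantum instructions: classical randomized algorithms with sample access. -/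
def Program.IsClassical : Program → Prop
  | .skip => True
  | .seq p q => p.IsClassical ∧ q.IsClassical
  | .push _ _ => True
  | .pop _ => True
  | .cases _ p q r => p.IsClassical ∧ q.IsClassical ∧ r.IsClassical
  | .loop _ p => p.IsClassical
  | .coin _ => True
  | .sample _ => True
  | .moveRight _ => False
  | .moveLeft _ => False
  | .hadamard => False
  | .tgate => False
  | .cnot => False
  | .measure _ => False

/-- Programs without coins, samples and quantum instructions: deterministic algorithms. -/
def Program.IsDeterministic : Program → Prop
  | .skip => True
  | .seq p q => p.IsDeterministic ∧ q.IsDeterministic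
  | .push _ _ => True
  | .pop _ => True
  | .cases _ p q r => p.IsDeterministic ∧ q.IsDeterministic ∧ r.IsDeterministic
  | .loop _ p => p.IsDeterministic
  | .coin _ => False
  | .sample _ => False
  | .moveRight _ => False
  | .moveLeft _ => False
  | .hadamard => False
  | .tgate => False
  | .cnot => False
  | .measure _ => False

/-- The two kinds of (learning) algorithms. -/
inductive Model where
  | classical
  | quantum

/-- `M.Admits p`: the program `p` is an algorithm of the kind `M`. Every classical program is also
a quantum program. -/
def Model.Admits : Model → Program → Prop
  | .classical, p => p.IsClassical
  | .quantum, _ => True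

/-- A pure state of the qubit tape, as a finite linear combination of computational basis
states; the basis state of a finite set `s` is the one in which exactly the qubits in `s` are 1.
States are not normalized after a measurement, so that the squared norm of the state of a
computation branch is the probability of the measurement results along that branch. -/
abbrev QState := Finset ℕ →₀ ℂ

namespace QState

/-- The squared norm. -/
def normSq (ψ : QState) : ℝ := ψ.sum fun _ a => ‖a‖ ^ 2

/-- The Hadamard gate on qubit `i`. -/
def hadamard (i : ℕ) (ψ : QState) : QState :=
  Finsupp.linearCombination ℂ (fun s : Finset ℕ =>
    (Finsupp.single (s.erase i) ((1 / Real.sqrt 2 : ℝ) : ℂ) +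
      Finsupp.single (insert i s) (((if i ∈ s then -1 else 1) / Real.sqrt 2 : ℝ) : ℂ) : QState)) ψ

/-- The T gate on qubit `i`. -/
def tgate (i : ℕ) (ψ : QState) : QState :=
  Finsupp.linearCombination ℂ (fun s : Finset ℕ =>
    (Finsupp.single s (if i ∈ s then Complex.exp (Complex.I * Real.pi / 4) else 1) : QState)) ψ

/-- The CNOT gate with control `i` and target `j`; the identity if `i = j`. -/
def cnot (i j : ℕ) (ψ : QState) : QState :=
  Finsupp.linearCombination ℂ (fun s : Finset ℕ =>
    (Finsupp.single (if i ∈ s ∧ i ≠ j then symmDiff s {j} else s) 1 : QState)) ψ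

/-- The unnormalized state after a measurement of qubit `i` with result `b`. -/
def project (i : ℕ) (b : Bool) (ψ : QState) : QState :=
  ψ.filter fun s => (i ∈ s ↔ b = true)

end QState

/-- The memory of the machine. -/
structure Memory where
  stack : ℕ → List Bool
  head : Bool → ℕ
  qubits : QState

/-- Replace the content of stack `i`. -/
def Memory.setStack (σ : Memory) (i : ℕ) (l : List Bool) : Memory :=
  { σ with stack := Function.update σ.stack i l }

/-- The initial memory: the inputs are on stacks 0, 1, 2, …, the other stacks are empty, the qubit
heads are at position 0 and all qubits are in the state 0. -/
def Memory.initial (inputs : List (List Bool)) : Memory where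
  stack := fun i => inputs.getD i []
  head := fun _ => 0
  qubits := Finsupp.single ∅ 1

/-- `successProb P good t K σ` is the probability that the machine, started with memory `σ` and
with the programs in the list `K` to be executed one after the other, halts within `t` steps with
an output (the content of stack 0) that satisfies `good`; `P` is the distribution from which
the sample oracle draws. -/
def successProb {n : ℕ} (P : Bits n → ℝ) (good : List Bool → Prop) :
    ℕ → List Program → Memory → ℝ
  | _, [], σ => open Classical in if good (σ.stack 0) then σ.qubits.normSq else 0
  | 0, _ :: _, _ => 0
  | t + 1, .skip :: K, σ => successProb P good t K σ
  | t + 1, .seq p q :: K, σ => successProb P good t (p :: q :: K) σ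
  | t + 1, .push i b :: K, σ => successProb P good t K (σ.setStack i (b :: σ.stack i))
  | t + 1, .pop i :: K, σ => successProb P good t K (σ.setStack i (σ.stack i).tail)
  | t + 1, .cases i p q r :: K, σ =>
      match σ.stack i with
      | [] => successProb P good t (p :: K) σ
      | false :: _ => successProb P good t (q :: K) σ
      | true :: _ => successProb P good t (r :: K) σ
  | t + 1, .loop i p :: K, σ =>
      match σ.stack i with
      | [] => successProb P good t K σ
      | _ :: _ => successProb P good t (p :: .loop i p :: K) σ
  | t + 1, .coin i :: K, σ =>
      ∑ b : Bool, 1 / 2 * successProb P good t K (σ.setStack i (b :: σ.stack i))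
  | t + 1, .sample i :: K, σ =>
      ∑ x : Bits n, P x * successProb P good t K (σ.setStack i (List.ofFn x))
  | t + 1, .moveRight h :: K, σ =>
      successProb P good t K { σ with head := Function.update σ.head h (σ.head h + 1) }
  | t + 1, .moveLeft h :: K, σ =>
      successProb P good t K { σ with head := Function.update σ.head h (σ.head h - 1) }
  | t + 1, .hadamard :: K, σ =>
      successProb P good t K { σ with qubits := σ.qubits.hadamard (σ.head false) }
  | t + 1, .tgate :: K, σ =>
      successProb P good t K { σ with qubits := σ.qubits.tgate (σ.head false) }
  | t + 1, .cnot :: K, σ =>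
      successProb P good t K { σ with qubits := σ.qubits.cnot (σ.head false) (σ.head true) }
  | t + 1, .measure i :: K, σ =>
      ∑ b : Bool, successProb P good t K
        { σ.setStack i (b :: σ.stack i) with qubits := σ.qubits.project (σ.head false) b }

/-- The probability that program `A` with sample access to `P`, run on the given inputs, halts
within `t` steps with an output that satisfies `good`. -/
def runProb {n : ℕ} (A : Program) (P : Bits n → ℝ) (inputs : List (List Bool)) (t : ℕ)
    (good : List Bool → Prop) : ℝ :=
  successProb P good t [A] (Memory.initial inputs)

/-- The deterministic program `V` halts on the given inputs within `t` steps, with an output that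
satisfies `good`. (A deterministic program never uses its oracle, so a dummy one is supplied.) -/
def Outputs (V : Program) (inputs : List (List Bool)) (t : ℕ) (good : List Bool → Prop) : Prop :=
  runProb V (fun _ : Bits 0 => 1) inputs t good = 1

/-- The number `m` in unary notation. -/
def unary (m : ℕ) : List Bool := List.replicate m true

/-- The natural number with binary notation `l`, least significant bit first. -/
def binaryValue (l : List Bool) : ℕ := Nat.ofDigits 2 (l.map Bool.toNat)

/-! ## Learning distributions with respect to an evaluator -/

/-- The deterministic program `V` together with the string `w` is an evaluator for `Q`: on input of
`w`, a point `x` and a precision `m`, `V` outputs the probability `Q x` up to an error of `2 ^ (-m)`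
(as an integer multiple of `2 ^ (-m)` in binary), within `t m` steps. -/
def IsEvaluator {n : ℕ} (V : Program) (w : List Bool) (t : ℕ → ℕ) (Q : Bits n → ℝ) : Prop :=
  ∀ (x : Bits n) (m : ℕ), Outputs V [w, List.ofFn x, unary m] (t m)
    fun out => |(binaryValue out : ℝ) / 2 ^ m - Q x| ≤ 1 / 2 ^ m

/-- The family `n ↦ D n` of distribution classes is efficiently learnable from samples with respect
to an evaluator, by an algorithm of the kind `M`: there is an algorithm `A` which, for all `n`, all
`P ∈ D n` and all `ε, δ ∈ (0, 1)`, with probability at least `1 - δ` outputs within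
`poly (n, 1/ε, 1/δ)` steps an efficient evaluator of a distribution `Q` with `TV (P, Q) < ε`. The
parameters are given to `A` as `n`, `⌈1/ε⌉` and `⌈1/δ⌉` in unary notation. The evaluator is described by a string `w`, which is interpreted by the fixed program `V`. -/
def EvaluatorLearnable (M : Model) (D : (n : ℕ) → Set (Bits n → ℝ)) : Prop :=
  ∃ (A V : Program) (p : Polynomial ℕ), M.Admits A ∧ V.IsDeterministic ∧
    ∀ (n : ℕ), ∀ P ∈ D n, ∀ ε δ : ℝ, 0 < ε → ε < 1 → 0 < δ → δ < 1 →
      1 - δ ≤ runProb A P [unary n, unary ⌈1 / ε⌉₊, unary ⌈1 / δ⌉₊]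
        (p.eval (n + ⌈1 / ε⌉₊ + ⌈1 / δ⌉₊))
        fun w => ∃ Q ∈ stdSimplex ℝ (Bits n), tvDist P Q < ε ∧
          IsEvaluator V w (fun m => p.eval (n + ⌈1 / ε⌉₊ + ⌈1 / δ⌉₊ + m)) Q

/-! ## Learning parities with noise -/

/-- The parity function `x ↦ s · x` modulo 2. -/
def parity {k : ℕ} (s x : Bits k) : Bool := (∑ i, (s i && x i).toNat).bodd

/-- The distribution of a noisy example `(x, y)` of the parity function of `s`: `x` is uniformly
random in `{0,1}ᵏ`, and the last bit `y` is the parity of `x`, flipped with probability `η`. -/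
def noisyParity {k : ℕ} (η : ℝ) (s : Bits k) : Bits (k + 1) → ℝ := fun z =>
  (1 / 2 ^ k) * if z (Fin.last k) = parity s (fun i => z i.castSucc) then 1 - η else η

/-- The class of parity functions is efficiently learnable under the uniform distribution with
random classification noise of rate `η`, by an algorithm of the kind `M`: from noisy examples, in
time `poly (k, 1/ε, 1/δ)` and with probability at least `1 - δ`, the algorithm outputs an efficiently
computable hypothesis `h` with `Pr_x [h x ≠ s · x] < ε`. The hypothesis is described by a string
`w`, which is interpreted by the fixed program `V`. -/
def NoisyParityLearnable (M : Model) (η : ℝ) : Prop :=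
  ∃ (A V : Program) (p : Polynomial ℕ), M.Admits A ∧ V.IsDeterministic ∧
    ∀ (k : ℕ) (s : Bits k), ∀ ε δ : ℝ, 0 < ε → ε < 1 → 0 < δ → δ < 1 →
      1 - δ ≤ runProb A (noisyParity η s) [unary k, unary ⌈1 / ε⌉₊, unary ⌈1 / δ⌉₊]
        (p.eval (k + ⌈1 / ε⌉₊ + ⌈1 / δ⌉₊))
        fun w => ∃ h : Bits k → Bool,
          ((Finset.univ.filter fun x => h x ≠ parity s x).card : ℝ) / 2 ^ k < ε ∧
          ∀ x, Outputs V [w, List.ofFn x] (p.eval (k + ⌈1 / ε⌉₊ + ⌈1 / δ⌉₊))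
            fun out => out = [h x]

/-- The learning-parities-with-noise assumption at noise rate `η`, for algorithms of the kind `M`. -/
def LPNAssumption (M : Model) (η : ℝ) : Prop := ¬ NoisyParityLearnable M η

end CircuitLearning

end

namespace CircuitLearning

open Function (update)

/-! ## Semantics of programs -/

section Semantics

variable {n : ℕ} {P : Bits n → ℝ}

/-! Noisy parity samples with a fixed block of zeros in front are output samples of a shallow local
circuit, and an accurate evaluator of their distribution reveals the parity. A distribution learner
would therefore break LPN.

The circuit: a rotation prepares a noise bit of rate `η`, and `k` two-qubit gates then carry it
along the line. Gate `j` leaves a fresh uniform bit `x_j` behind and adds `s_j x_j` to the carried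
bit, so after `k + 1` layers the last qubit holds the noise plus `s · x`
(`parityGate_apply_ladderState`, `zeroPad_noisyParity_mem_circuitDistributions`). Only `d n ≥ n ^ c`
is known, so `(k + K₀) ^ r` zeros with `r = ⌈1/c⌉` are put in front: still polynomially many, but
enough to make the permitted depth exceed `k`.

The hypothesis: the two labels of a point `x` have weights `(1 - η) / 2 ^ k` and `η / 2 ^ k`, and
the label of larger evaluated weight is predicted. Every wrong prediction contributes almost `(1 -
2η) / 2 ^ k` to twice the total variation distance, so an accuracy of order `(1 - 2η) ε` for the
distribution gives error below `ε` (`card_ne_parity_le`).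

The rest is programming with time bounds. `successProb_le_simulate` runs a program on renamed stacks
with postprocessed samples; quantum instructions are copied unchanged, so the kind of algorithm is
preserved. A running time bounds the length of the output (`successProb_le_of_length_le`), so
descriptions and computed values can be copied and compared in polynomial time. A deterministic
evaluator has one definite output (`Outputs.exists_eq`), so the predicted label is a well-defined
function of the point. Success probabilities are mostly bounded from below only, which is all that
learnability asks for. -/

theorem QState.normSq_nonneg (ψ : QState) : 0 ≤ ψ.normSq :=
  Finset.sum_nonneg fun _ _ => by positivity

theorem successProb_nil (P : Bits n → ℝ) (good : List Bool → Prop) (t : ℕ) (σ : Memory) :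
    successProb P good t [] σ =
      open Classical in if good (σ.stack 0) then σ.qubits.normSq else 0 := by
  cases t <;> simp only [successProb]

theorem successProb_nonneg (hP : ∀ x, 0 ≤ P x) (good : List Bool → Prop) (t : ℕ)
    (K : List Program) (σ : Memory) : 0 ≤ successProb P good t K σ := by
  induction t generalizing K σ with
  | zero =>
    cases K with
    | nil => rw [successProb_nil]; split_ifs <;> simp [QState.normSq_nonneg]
    | cons p K => simp [successProb]
  | succ t ih =>
    cases K with
    | nil => rw [successProb_nil]; split_ifs <;> simp [QState.normSq_nonneg]
    | cons p K =>
      cases p <;> simp only [successProb]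
      case cases i p q r => split <;> apply ih
      case loop i p => split <;> apply ih
      case coin i => exact Finset.sum_nonneg fun b _ => mul_nonneg (by norm_num) (ih _ _)
      case sample i => exact Finset.sum_nonneg fun x _ => mul_nonneg (hP x) (ih _ _)
      case measure i => exact Finset.sum_nonneg fun b _ => ih _ _
      all_goals apply ih

theorem successProb_le_succ (hP : ∀ x, 0 ≤ P x) (good : List Bool → Prop) (t : ℕ)
    (K : List Program) (σ : Memory) :
    successProb P good t K σ ≤ successProb P good (t + 1) K σ := by
  induction t generalizing K σ with
  | zero =>
    cases K with
    | nil => simp only [successProb_nil, le_refl]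
    | cons p K => exact le_of_eq_of_le (by simp [successProb]) (successProb_nonneg hP _ _ _ _)
  | succ t ih =>
    cases K with
    | nil => simp only [successProb_nil, le_refl]
    | cons p K =>
      cases p
      all_goals rw [successProb, successProb]
      case cases i p q r => split <;> apply ih
      case loop i p => split <;> apply ih
      case coin i =>
        exact Finset.sum_le_sum fun b _ => mul_le_mul_of_nonneg_left (ih _ _) (by norm_num)
      case sample i =>
        exact Finset.sum_le_sum fun x _ => mul_le_mul_of_nonneg_left (ih _ _) (hP x)
      case measure i => exact Finset.sum_le_sum fun b _ => ih _ _
      all_goals apply ih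

theorem successProb_mono (hP : ∀ x, 0 ≤ P x) (good : List Bool → Prop)
    (K : List Program) (σ : Memory) : Monotone fun t => successProb P good t K σ :=
  monotone_nat_of_le_succ fun t => successProb_le_succ hP good t K σ

theorem successProb_seq_le (hP : ∀ x, 0 ≤ P x) (good : List Bool → Prop) (p q : Program)
    (K : List Program) (σ : Memory) {t t' : ℕ} (h : t + 1 ≤ t') :
    successProb P good t (p :: q :: K) σ ≤ successProb P good t' (.seq p q :: K) σ := by
  refine le_trans (le_of_eq ?_) (successProb_mono hP good _ σ h)
  simp only [successProb]

/-- A machine that starts with stacks of height at most `M`, and draws samples of length at most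
`M`, has stacks of height at most `M + t` after `t` steps. -/
theorem successProb_le_of_length_le (hP : ∀ x, 0 ≤ P x) {good good' : List Bool → Prop}
    (t M : ℕ) (hn : n ≤ M) (hgood : ∀ l : List Bool, l.length ≤ M + t → good l → good' l)
    (K : List Program) (σ : Memory) (hσ : ∀ i, (σ.stack i).length ≤ M) :
    successProb P good t K σ ≤ successProb P good' t K σ := by
  have hnil : ∀ (t M : ℕ) (_ : ∀ l : List Bool, l.length ≤ M + t → good l → good' l)
      (σ : Memory) (_ : ∀ i, (σ.stack i).length ≤ M),
      successProb P good t [] σ ≤ successProb P good' t [] σ := by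
    intro t M hgood σ hσ
    have h0 := hσ 0
    rw [successProb_nil, successProb_nil]
    split_ifs with h h'
    · exact le_rfl
    · exact absurd (hgood _ (by omega) h) h'
    · exact QState.normSq_nonneg _
    · exact le_rfl
  induction t generalizing K σ M with
  | zero =>
    cases K with
    | nil => exact hnil 0 M hgood σ hσ
    | cons p K => simp [successProb]
  | succ t ih =>
    cases K with
    | nil => exact hnil (t + 1) M hgood σ hσ
    | cons p K =>
      have same : ∀ K σ, (∀ i, (σ.stack i).length ≤ M) →
          successProb P good t K σ ≤ successProb P good' t K σ :=
        fun K σ h => ih M hn (fun l hl => hgood l (by omega)) K σ h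
      have push : ∀ K i b, successProb P good t K (σ.setStack i (b :: σ.stack i)) ≤
          successProb P good' t K (σ.setStack i (b :: σ.stack i)) := by
        -- A push raises the height bound by one and uses up one step, so `M + t` is unchanged.
        refine fun K i b => ih (M + 1) (by omega) (fun l hl => hgood l (by omega)) K _ fun j => ?_
        have := hσ j
        by_cases hj : j = i
        · subst hj; simp [Memory.setStack, this]
        · simp [Memory.setStack, hj]; omega
      cases p
      all_goals rw [successProb, successProb]
      case cases i p q r => split <;> exact same _ _ hσ
      case loop i p => split <;> exact same _ _ hσ
      case coin i =>
        exact Finset.sum_le_sum fun b _ => mul_le_mul_of_nonneg_left (push _ _ _) (by norm_num)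
      case sample i =>
        refine Finset.sum_le_sum fun x _ => mul_le_mul_of_nonneg_left (same _ _ fun j => ?_) (hP x)
        by_cases hj : j = i
        · subst hj; simp [Memory.setStack, hn]
        · simpa [Memory.setStack, hj] using hσ j
      case measure i =>
        refine Finset.sum_le_sum fun b _ => ih (M + 1) (by omega)
          (fun l hl => hgood l (by omega)) K _ fun j => ?_
        have := hσ j
        by_cases hj : j = i
        · subst hj; simp [Memory.setStack, this]
        · simp [Memory.setStack, hj]; omega
      case push i b => exact push _ _ _
      case pop i =>
        refine same _ _ fun j => ?_
        have := hσ j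
        by_cases hj : j = i
        · subst hj; simp [Memory.setStack]; omega
        · simpa [Memory.setStack, hj] using hσ j
      all_goals exact same _ _ hσ

/-- A deterministic program either does not halt in time or has a unique output, which depends
only on the stacks. -/
theorem successProb_deterministic (t : ℕ) (K : List Program) (hK : ∀ p ∈ K, p.IsDeterministic)
    (s : ℕ → List Bool) :
    (∀ {n : ℕ} (P : Bits n → ℝ) (good : List Bool → Prop) (σ : Memory), σ.stack = s →
      successProb P good t K σ = 0) ∨
    ∃ out, ∀ {n : ℕ} (P : Bits n → ℝ) (good : List Bool → Prop) (σ : Memory), σ.stack = s →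
      successProb P good t K σ = open Classical in if good out then σ.qubits.normSq else 0 := by
  induction t generalizing K s with
  | zero =>
    cases K with
    | nil => exact .inr ⟨s 0, fun P good σ hσ => by rw [successProb_nil, hσ]⟩
    | cons p K => exact .inl fun P good σ _ => by simp [successProb]
  | succ t ih =>
    cases K with
    | nil => exact .inr ⟨s 0, fun P good σ hσ => by rw [successProb_nil, hσ]⟩
    | cons p K =>
      obtain ⟨hp, hK'⟩ := List.forall_mem_cons.1 hK
      -- No deterministic instruction branches or touches the qubits: each one only changes the
      -- continuation and the stacks, in a way determined by `s`.
      have step : ∀ (K' : List Program) (s' : ℕ → List Bool), (∀ p ∈ K', p.IsDeterministic) →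
          (∀ {n : ℕ} (P : Bits n → ℝ) (good : List Bool → Prop) (σ : Memory), σ.stack = s →
            successProb P good (t + 1) (p :: K) σ =
              successProb P good t K' { σ with stack := s' }) →
          ((∀ {n : ℕ} (P : Bits n → ℝ) (good : List Bool → Prop) (σ : Memory), σ.stack = s →
            successProb P good (t + 1) (p :: K) σ = 0) ∨
          ∃ out, ∀ {n : ℕ} (P : Bits n → ℝ) (good : List Bool → Prop) (σ : Memory), σ.stack = s →
            successProb P good (t + 1) (p :: K) σ =
              open Classical in if good out then σ.qubits.normSq else 0) := by
        intro K' s' hdet heq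
        rcases ih K' hdet s' with h | ⟨out, h⟩
        · exact .inl fun P good σ hσ => (heq P good σ hσ).trans (h P good _ rfl)
        · exact .inr ⟨out, fun P good σ hσ => (heq P good σ hσ).trans (h P good _ rfl)⟩
      cases p <;> simp only [Program.IsDeterministic] at hp
      case cases i p q r =>
        rcases hs : s i with _ | ⟨_ | _, l⟩
        · refine step (p :: K) s (List.forall_mem_cons.2 ⟨hp.1, hK'⟩) ?_
          rintro n P good σ rfl
          rw [successProb, hs]
        · refine step (q :: K) s (List.forall_mem_cons.2 ⟨hp.2.1, hK'⟩) ?_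
          rintro n P good σ rfl
          rw [successProb, hs]
        · refine step (r :: K) s (List.forall_mem_cons.2 ⟨hp.2.2, hK'⟩) ?_
          rintro n P good σ rfl
          rw [successProb, hs]
      case loop i p =>
        rcases hs : s i with _ | ⟨b, l⟩
        · refine step K s hK' ?_
          rintro n P good σ rfl
          rw [successProb, hs]
        · refine step (p :: .loop i p :: K) s
            (List.forall_mem_cons.2 ⟨hp, List.forall_mem_cons.2 ⟨hp, hK'⟩⟩) ?_
          rintro n P good σ rfl
          rw [successProb, hs]
      case seq p q =>
        refine step (p :: q :: K) s
          (List.forall_mem_cons.2 ⟨hp.1, List.forall_mem_cons.2 ⟨hp.2, hK'⟩⟩) ?_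
        rintro n P good σ rfl
        rw [successProb]
      case skip =>
        refine step K s hK' ?_
        rintro n P good σ rfl
        rw [successProb]
      case push i b =>
        refine step K (update s i (b :: s i)) hK' ?_
        rintro n P good σ rfl
        rw [successProb]
        rfl
      case pop i =>
        refine step K (update s i (s i).tail) hK' ?_
        rintro n P good σ rfl
        rw [successProb]
        rfl

theorem normSq_initial (inputs : List (List Bool)) : (Memory.initial inputs).qubits.normSq = 1 := by
  simp [Memory.initial, QState.normSq]

/-- Without branching the value is 0 or the squared norm 1 of the initial state. With this, the
lower bounds obtained for deterministic programs become the equality demanded by `Outputs`. -/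
theorem runProb_le_one {A : Program} (hA : A.IsDeterministic) (P : Bits n → ℝ)
    (inputs : List (List Bool)) (t : ℕ) (good : List Bool → Prop) :
    runProb A P inputs t good ≤ 1 := by
  unfold runProb
  rcases successProb_deterministic t [A] (by simpa using hA) (Memory.initial inputs).stack with
    h | ⟨out, h⟩
  · simp [h P good _ rfl]
  · rw [h P good _ rfl, normSq_initial]; split_ifs <;> norm_num

theorem length_stack_initial_le {inputs : List (List Bool)} {M : ℕ}
    (hM : ∀ l ∈ inputs, l.length ≤ M) (i : ℕ) :
    ((Memory.initial inputs).stack i).length ≤ M := by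
  by_cases hi : i < inputs.length
  · simpa [Memory.initial, hi] using hM _ (List.getElem_mem hi)
  · simp [Memory.initial, not_lt.1 hi]

/-- If a deterministic program halts with a good output, this output is unique and it is not longer
than the longest input plus the running time. -/
theorem Outputs.exists_eq {V : Program} (hV : V.IsDeterministic) {inputs : List (List Bool)}
    {t M : ℕ} {good : List Bool → Prop} (h : Outputs V inputs t good)
    (hM : ∀ l ∈ inputs, l.length ≤ M) :
    ∃ out, good out ∧ out.length ≤ M + t ∧
      ∀ {n : ℕ} (P : Bits n → ℝ) (σ : Memory), σ.stack = (Memory.initial inputs).stack →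
        successProb P (· = out) t [V] σ = σ.qubits.normSq := by
  -- The length bound goes into the predicate before the unique output is extracted, so that this
  -- output inherits it.
  have hlen : Outputs V inputs t (fun out => good out ∧ out.length ≤ M + t) := by
    refine le_antisymm (runProb_le_one hV _ _ _ _) (h.symm.le.trans ?_)
    refine successProb_le_of_length_le (fun _ => zero_le_one) t M (Nat.zero_le _)
      (fun l hl hg => ⟨hg, hl⟩) _ _ (length_stack_initial_le hM)
  unfold Outputs runProb at hlen
  rcases successProb_deterministic t [V] (by simpa using hV) (Memory.initial inputs).stack with
    h' | ⟨out, h'⟩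
  · simp [h' _ _ _ rfl] at hlen
  · rw [h' _ _ _ rfl, normSq_initial] at hlen
    split_ifs at hlen with hg
    · exact ⟨out, hg.1, hg.2, fun P σ hσ => by simp [h' P _ σ hσ]⟩
    · norm_num at hlen

end Semantics

/-! ## Running classical programs on the stacks -/

/-- Started with stacks `s`, the program `p` halts within `t` steps with stacks `s'`, without
touching the qubits. -/
structure Runs (p : Program) (s : ℕ → List Bool) (t : ℕ) (s' : ℕ → List Bool) : Prop where
  le_successProb : ∀ {n : ℕ} (P : Bits n → ℝ) (_ : ∀ x, 0 ≤ P x) (good : List Bool → Prop) (u : ℕ)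
    (K : List Program) (σ : Memory), σ.stack = s →
    successProb P good u K { σ with stack := s' } ≤ successProb P good (t + u) (p :: K) σ

namespace Runs

variable {p q r : Program} {s s' s'' : ℕ → List Bool} {t t' i : ℕ} {b : Bool}

theorem mono (h : Runs p s t s') (htt' : t ≤ t') : Runs p s t' s' :=
  ⟨fun P hP good u K σ hσ => (h.le_successProb P hP good u K σ hσ).trans
    (successProb_mono hP good _ σ (by omega))⟩

theorem congr (h : Runs p s t s') (hs : s' = s'') : Runs p s t s'' := hs ▸ h

theorem skip (s : ℕ → List Bool) : Runs .skip s 1 s := by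
  constructor
  rintro n P hP good u K σ rfl
  rw [Nat.add_comm, successProb]

theorem push (s : ℕ → List Bool) (i : ℕ) (b : Bool) :
    Runs (.push i b) s 1 (update s i (b :: s i)) := by
  constructor
  rintro n P hP good u K σ rfl
  rw [Nat.add_comm, successProb]
  rfl

theorem pop (s : ℕ → List Bool) (i : ℕ) : Runs (.pop i) s 1 (update s i (s i).tail) := by
  constructor
  rintro n P hP good u K σ rfl
  rw [Nat.add_comm, successProb]
  rfl

theorem seq (hp : Runs p s t s') (hq : Runs q s' t' s'') :
    Runs (.seq p q) s (1 + t + t') s'' := by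
  constructor
  rintro n P hP good u K σ hσ
  rw [show 1 + t + t' + u = (t + (t' + u)) + 1 by ring, successProb]
  exact (hq.le_successProb P hP good u K { σ with stack := s' } rfl).trans
    (hp.le_successProb P hP good (t' + u) (q :: K) σ hσ)

theorem cases_nil (hs : s i = []) (h : Runs p s t s') : Runs (.cases i p q r) s (1 + t) s' := by
  constructor
  rintro n P hP good u K σ rfl
  rw [show 1 + t + u = (t + u) + 1 by ring, successProb, hs]
  exact h.le_successProb P hP good u K σ rfl

theorem cases_false {l : List Bool} (hs : s i = false :: l) (h : Runs q s t s') :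
    Runs (.cases i p q r) s (1 + t) s' := by
  constructor
  rintro n P hP good u K σ rfl
  rw [show 1 + t + u = (t + u) + 1 by ring, successProb, hs]
  exact h.le_successProb P hP good u K σ rfl

theorem cases_true {l : List Bool} (hs : s i = true :: l) (h : Runs r s t s') :
    Runs (.cases i p q r) s (1 + t) s' := by
  constructor
  rintro n P hP good u K σ rfl
  rw [show 1 + t + u = (t + u) + 1 by ring, successProb, hs]
  exact h.le_successProb P hP good u K σ rfl

theorem loop_nil (hs : s i = []) : Runs (.loop i p) s 1 s := by
  constructor
  rintro n P hP good u K σ rfl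
  rw [Nat.add_comm, successProb, hs]

theorem loop_cons {l : List Bool} (hs : s i = b :: l) (hp : Runs p s t s')
    (hl : Runs (.loop i p) s' t' s'') : Runs (.loop i p) s (1 + t + t') s'' := by
  constructor
  rintro n P hP good u K σ rfl
  rw [show 1 + t + t' + u = (t + (t' + u)) + 1 by ring, successProb, hs]
  exact (hl.le_successProb P hP good u K { σ with stack := s' } rfl).trans
    (hp.le_successProb P hP good (t' + u) (.loop i p :: K) σ rfl)

end Runs

/-! ## Simulation with renamed stacks and a modified oracle -/

/-- The program `p` with stack `i` renamed to `f i`, in which every sample is postprocessed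
by the program `pad`. -/
def Program.simulate (f : ℕ → ℕ) (pad : ℕ → Program) : Program → Program
  | .skip => .skip
  | .seq p q => .seq (p.simulate f pad) (q.simulate f pad)
  | .push i b => .push (f i) b
  | .pop i => .pop (f i)
  | .cases i p q r => .cases (f i) (p.simulate f pad) (q.simulate f pad) (r.simulate f pad)
  | .loop i p => .loop (f i) (p.simulate f pad)
  | .coin i => .coin (f i)
  | .sample i => .seq (.sample (f i)) (pad (f i))
  | .moveRight h => .moveRight h
  | .moveLeft h => .moveLeft h
  | .hadamard => .hadamard
  | .tgate => .tgate
  | .cnot => .cnot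
  | .measure i => .measure (f i)

theorem Program.IsDeterministic.simulate (f : ℕ → ℕ) (pad : ℕ → Program) {p : Program}
    (hp : p.IsDeterministic) : (p.simulate f pad).IsDeterministic := by
  induction p <;> simp_all [Program.simulate, Program.IsDeterministic]

theorem Program.IsDeterministic.isClassical {p : Program} (hp : p.IsDeterministic) :
    p.IsClassical := by
  induction p <;> simp_all [Program.IsClassical, Program.IsDeterministic]

theorem Program.IsClassical.simulate (f : ℕ → ℕ) {pad : ℕ → Program}
    (hpad : ∀ i, (pad i).IsClassical) {p : Program}
    (hp : p.IsClassical) : (p.simulate f pad).IsClassical := by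
  induction p <;> simp_all [Program.simulate, Program.IsClassical]

/-- The memory `σ'` of a simulation agrees with the memory `σ` of the simulated program, up to the
renaming `f` of the stacks, and its other stacks are those of `s₀`. -/
structure Simulates (f : ℕ → ℕ) (s₀ : ℕ → List Bool) (σ σ' : Memory) : Prop where
  stack_apply : ∀ i, σ'.stack (f i) = σ.stack i
  stack_of_notMem : ∀ j ∉ Set.range f, σ'.stack j = s₀ j
  head_eq : σ'.head = σ.head
  qubits_eq : σ'.qubits = σ.qubits

theorem Simulates.setStack {f : ℕ → ℕ} (hf : f.Injective) {s₀ : ℕ → List Bool} {σ σ' : Memory}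
    (h : Simulates f s₀ σ σ') (i : ℕ) (l : List Bool) :
    Simulates f s₀ (σ.setStack i l) (σ'.setStack (f i) l) := by
  refine ⟨fun j => ?_, fun j hj => ?_, h.head_eq, h.qubits_eq⟩
  · by_cases hj : j = i
    · subst hj; simp [Memory.setStack]
    · simp [Memory.setStack, hj, hf.ne hj, h.stack_apply]
  · have : j ≠ f i := fun e => hj ⟨i, e.symm⟩
    simp [Memory.setStack, this, h.stack_of_notMem j hj]

/-- The success probability of a program is at most that of its simulation, if the postprocessed
samples have the right distribution. -/
theorem successProb_le_simulate {n m : ℕ} {P : Bits n → ℝ} {P' : Bits m → ℝ}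
    (hP' : ∀ x, 0 ≤ P' x)
    {f : ℕ → ℕ} (hf : f.Injective) {pad : ℕ → Program} {pre : List Bool} {s₀ : ℕ → List Bool}
    {tp : ℕ}
    (hpre : ∀ F : List Bool → ℝ,
      ∑ x, P x * F (List.ofFn x) = ∑ z, P' z * F (pre ++ List.ofFn z))
    (hpad : ∀ i s, (∀ j ∉ Set.range f, s j = s₀ j) →
      Runs (pad (f i)) s tp (update s (f i) (pre ++ s (f i))))
    {good good' : List Bool → Prop} {K' : List Program} {T : ℕ}
    (hfinal : ∀ σ σ', Simulates f s₀ σ σ' → good (σ.stack 0) →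
      σ.qubits.normSq ≤ successProb P' good' T K' σ')
    (t : ℕ) (K : List Program) (σ σ' : Memory) (hσ : Simulates f s₀ σ σ') :
    successProb P good t K σ ≤
      successProb P' good' (t * (tp + 2) + T) (K.map (Program.simulate f pad) ++ K') σ' := by
  have hnil : ∀ t σ σ', Simulates f s₀ σ σ' → successProb P good t [] σ ≤
      successProb P' good' (t * (tp + 2) + T) ([].map (Program.simulate f pad) ++ K') σ' := by
    intro t σ σ' hσ
    rw [successProb_nil]
    split_ifs with h
    · exact (hfinal σ σ' hσ h).trans (successProb_mono hP' good' _ _ (by omega))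
    · exact successProb_nonneg hP' _ _ _ _
  induction t generalizing K σ σ' with
  | zero =>
    cases K with
    | nil => exact hnil _ _ _ hσ
    | cons p K => exact le_of_eq_of_le (by simp [successProb]) (successProb_nonneg hP' _ _ _ _)
  | succ t ih =>
    cases K with
    | nil => exact hnil _ _ _ hσ
    | cons p K =>
      -- The costliest simulated instruction is `sample`: one step for `seq`, one for the draw and
      -- `tp` for the postprocessing. All others cost a single step and leave `tp + 1` unused.
      have hle : t * (tp + 2) + T ≤ t * (tp + 2) + T + (tp + 1) := by omega
      have ih' : ∀ K σ σ', Simulates f s₀ σ σ' → successProb P good t K σ ≤ successProb P' good'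
          (t * (tp + 2) + T + (tp + 1)) (K.map (Program.simulate f pad) ++ K') σ' :=
        fun K σ σ' h => (ih K σ σ' h).trans (successProb_mono hP' _ _ _ hle)
      rw [show (t + 1) * (tp + 2) + T = t * (tp + 2) + T + (tp + 1) + 1 by ring]
      rw [List.map_cons, List.cons_append]
      cases p
      all_goals simp only [Program.simulate]
      all_goals rw [successProb, successProb]
      case cases i p q r =>
        rw [hσ.stack_apply]
        split
        · exact ih' (p :: K) _ _ hσ
        · exact ih' (q :: K) _ _ hσ
        · exact ih' (r :: K) _ _ hσ
      case loop i p =>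
        rw [hσ.stack_apply]
        split
        · exact ih' K _ _ hσ
        · exact ih' (p :: .loop i p :: K) _ _ hσ
      case coin i =>
        refine Finset.sum_le_sum fun b _ => mul_le_mul_of_nonneg_left ?_ (by norm_num)
        rw [hσ.stack_apply]
        exact ih' K _ _ (hσ.setStack hf i _)
      case sample i =>
        -- `hpre` replaces the average over `P` by one over `P'` with the prefix `pre` added, which
        -- is what `pad` will produce.
        rw [← add_assoc, successProb, hpre fun l => successProb P good t K (σ.setStack i l)]
        refine Finset.sum_le_sum fun z _ => mul_le_mul_of_nonneg_left ?_ (hP' z)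
        have hz := hσ.setStack hf i (List.ofFn z)
        have h1 := (hpad i _ hz.stack_of_notMem).le_successProb P' hP' good' (t * (tp + 2) + T)
          (K.map (Program.simulate f pad) ++ K') _ rfl
        rw [add_comm tp (t * (tp + 2) + T)] at h1
        refine le_trans (ih K _ _ ?_) h1
        convert hσ.setStack hf i (pre ++ List.ofFn z) using 1
        simp [Memory.setStack]
      case measure i =>
        refine Finset.sum_le_sum fun b _ => ?_
        rw [hσ.stack_apply, hσ.head_eq, hσ.qubits_eq]
        refine ih' K _ _ ?_
        have := hσ.setStack hf i (b :: σ.stack i)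
        exact ⟨this.1, this.2, this.3, rfl⟩
      case push i b =>
        rw [hσ.stack_apply]
        exact ih' K _ _ (hσ.setStack hf i _)
      case pop i =>
        rw [hσ.stack_apply]
        exact ih' K _ _ (hσ.setStack hf i _)
      case skip => exact ih' K _ _ hσ
      case seq p q => exact ih' (p :: q :: K) _ _ hσ
      all_goals
        exact ih' K _ _ ⟨hσ.1, hσ.2, by simp [hσ.head_eq], by simp [hσ.head_eq, hσ.qubits_eq]⟩

/-! ## Classical subroutines -/

/-- Push the given bits onto the given stacks. -/
def pushes : List (ℕ × Bool) → Program
  | [] => .skip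
  | (i, b) :: L => .seq (.push i b) (pushes L)

@[simp]
theorem flatMap_nil_fun (l : List Bool) : (l.flatMap fun _ => ([] : List Bool)) = [] := by
  simp

@[simp]
theorem flatMap_const_true (l : List Bool) :
    (l.flatMap fun _ => [true]) = List.replicate l.length true := by
  induction l <;> simp_all [List.replicate_succ]

/-- What `pushes L` puts on top of stack `j`. -/
def pushed : List (ℕ × Bool) → ℕ → List Bool
  | [], _ => []
  | (i, b) :: L, j => pushed L j ++ if j = i then [b] else []

@[simp]
theorem pushed_append (L L' : List (ℕ × Bool)) (j : ℕ) :
    pushed (L ++ L') j = pushed L' j ++ pushed L j := by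
  induction L with
  | nil => simp [pushed]
  | cons a L ih => simp [pushed, ih]

@[simp]
theorem pushed_replicate (N i : ℕ) (b : Bool) (j : ℕ) :
    pushed (List.replicate N (i, b)) j = if j = i then List.replicate N b else [] := by
  induction N with
  | zero => simp [pushed]
  | succ N ih =>
    rw [List.replicate_succ, pushed, ih]
    split_ifs <;> simp [List.replicate_succ']

theorem runs_pushes (L : List (ℕ × Bool)) (s : ℕ → List Bool) :
    Runs (pushes L) s (2 * L.length + 1) fun j => pushed L j ++ s j := by
  induction L generalizing s with
  | nil => exact (Runs.skip s).congr (by simp [pushed])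
  | cons a L ih =>
    refine (((Runs.push s a.1 a.2).seq (ih _)).mono (by simp; omega)).congr (funext fun j => ?_)
    by_cases hj : j = a.1
    · subst hj; simp [pushed]
    · simp [pushed, hj]

theorem isDeterministic_pushes (L : List (ℕ × Bool)) : (pushes L).IsDeterministic := by
  induction L with
  | nil => trivial
  | cons a L ih => exact ⟨trivial, ih⟩

/-- Empty stack `a`, running `q b` for every bit `b` removed. -/
def consume (a : ℕ) (q : Bool → Program) : Program :=
  .loop a (.cases a .skip (.seq (.pop a) (q false)) (.seq (.pop a) (q true)))

theorem isDeterministic_consume (a : ℕ) {q : Bool → Program} (hq : ∀ b, (q b).IsDeterministic) :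
    (consume a q).IsDeterministic :=
  ⟨trivial, ⟨trivial, hq _⟩, trivial, hq _⟩

theorem runs_consume_cons {a : ℕ} {q : Bool → Program} {s s' s'' : ℕ → List Bool} {b : Bool}
    {l : List Bool} {t t' : ℕ} (hs : s a = b :: l) (hq : Runs (q b) (update s a l) t s')
    (h : Runs (consume a q) s' t' s'') : Runs (consume a q) s (t + 4 + t') s'' := by
  have hpop : Runs (.pop a) s 1 (update s a l) := (Runs.pop s a).congr (by rw [hs]; rfl)
  cases b
  · exact (Runs.loop_cons hs (.cases_false hs (hpop.seq hq)) h).mono (by omega)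
  · exact (Runs.loop_cons hs (.cases_true hs (hpop.seq hq)) h).mono (by omega)

/-- If `q b` puts `B b j` on top of stack `j` whenever the invariant `I` holds, then `consume a q`
does so for every bit `b` on stack `a`. -/
theorem runs_consume {a : ℕ} {q : Bool → Program} {B : Bool → ℕ → List Bool} {t : ℕ}
    (hB : ∀ b, B b a = []) (I : (ℕ → List Bool) → Prop)
    (hIpop : ∀ s l, I s → I (update s a l)) (hIq : ∀ s b, I s → I fun j => B b j ++ s j)
    (hq : ∀ s b, I s → Runs (q b) s t fun j => B b j ++ s j)
    (l : List Bool) (s : ℕ → List Bool) (hs : s a = l) (hI : I s) :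
    Runs (consume a q) s (l.length * (t + 4) + 1) fun j =>
      if j = a then [] else l.reverse.flatMap (fun b => B b j) ++ s j := by
  induction l generalizing s with
  | nil =>
    refine ((Runs.loop_nil hs).mono (by simp)).congr (funext fun j => ?_)
    split_ifs with h
    · rw [h, hs]
    · simp
  | cons b l ih =>
    have hI' := hIpop s l hI
    refine ((runs_consume_cons hs (hq _ b hI') (ih _ ?_ (hIq _ b hI'))).mono
      (by simp only [List.length_cons]; ring_nf; omega)).congr (funext fun j => ?_)
    · simp [hB]
    · split_ifs with h
      · rfl
      · simp [h]

/-- Empty stack `a`, pushing `L b` for every bit `b` removed. -/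
theorem runs_consume_pushes {a : ℕ} {L : Bool → List (ℕ × Bool)} {c : ℕ}
    (hc : ∀ b, (L b).length ≤ c) (ha : ∀ b, pushed (L b) a = []) (s : ℕ → List Bool) :
    Runs (consume a fun b => pushes (L b)) s ((s a).length * (2 * c + 5) + 1) fun j =>
      if j = a then [] else (s a).reverse.flatMap (fun b => pushed (L b) j) ++ s j :=
  runs_consume (t := 2 * c + 1) ha (fun _ => True) (fun _ _ _ => trivial) (fun _ _ _ => trivial)
    (fun s b _ => (runs_pushes (L b) s).mono (by have := hc b; omega)) _ s rfl trivial

/-- Multiply the unary number on stack 12 by that on stack 9. -/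
def mulStep : Program :=
  .seq
    (consume 12 fun _ => .seq
      (consume 9 fun _ => pushes [(18, true), (15, true)]) (consume 18 fun _ => pushes [(9, true)]))
    (consume 15 fun _ => pushes [(12, true)])

/-- Reading a stack destroys it, so each round copies stack 9 to both 15 and 18 and restores it from
18. All stacks used are multiples of 3, hence outside the ranges `3 i + 1` and `3 i + 2` reserved
for the two evaluator runs. -/
theorem runs_mulStep {β N : ℕ} {s : ℕ → List Bool} (h9 : s 9 = List.replicate β true)
    (h12 : s 12 = List.replicate N true) (h15 : s 15 = []) (h18 : s 18 = []) (hβ : 1 ≤ β) :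
    Runs mulStep s (30 * (N * β) + 3) (update s 12 (List.replicate (N * β) true)) := by
  have hbody : ∀ (s : ℕ → List Bool) (b : Bool), s 9 = List.replicate β true ∧ s 18 = [] →
      Runs (.seq (consume 9 fun _ => pushes [(18, true), (15, true)])
        (consume 18 fun _ => pushes [(9, true)])) s (16 * β + 3)
        fun j => (if j = 15 then List.replicate β true else []) ++ s j := by
    rintro s - ⟨h9, h18⟩
    have h1 := runs_consume_pushes (a := 9) (L := fun _ => [(18, true), (15, true)]) (c := 2)
      (by simp) (by simp [pushed]) s
    have h2 := fun s => runs_consume_pushes (a := 18) (L := fun _ => [(9, true)]) (c := 1)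
      (by simp) (by simp [pushed]) s
    refine ((h1.seq (h2 _)).mono ?_).congr (funext fun j => ?_)
    · simp [h9, h18, pushed, List.flatMap_replicate]; omega
    · by_cases j9 : j = 9
      · subst j9; simp [h9, h18, pushed, List.flatMap_replicate]
      by_cases j18 : j = 18
      · subst j18; simp [h18]
      by_cases j15 : j = 15
      · subst j15; simp [h9, pushed, List.flatMap_replicate]
      · simp [pushed, j9, j18, j15]
  have h1 := runs_consume (a := 12) (B := fun _ j => if j = 15 then List.replicate β true else [])
    (by simp) (fun s => s 9 = List.replicate β true ∧ s 18 = [])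
    (fun s l h => by simpa using h) (fun s _ h => by simpa using h) hbody _ s rfl ⟨h9, h18⟩
  have h2 := fun s => runs_consume_pushes (a := 15) (L := fun _ => [(12, true)]) (c := 1)
    (by simp) (by simp [pushed]) s
  refine ((h1.seq (h2 _)).mono ?_).congr (funext fun j => ?_)
  · simp [h12, h15]
    -- The cost is `23 N β + 7 N + 3`; the constant 30 absorbs `7 N` because `β ≥ 1`.
    nlinarith [Nat.mul_le_mul_left N hβ]
  · by_cases j12 : j = 12
    · subst j12; simp [h12, h15, pushed, List.flatMap_replicate]
    by_cases j15 : j = 15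
    · subst j15; simp [h15]
    · simp [pushed, j12, j15]

/-- Put the `r`-th power of the unary number on stack 9 onto stack 12. -/
def power : ℕ → Program
  | 0 => .push 12 true
  | r + 1 => .seq (power r) mulStep

theorem runs_power {β : ℕ} (r : ℕ) {s : ℕ → List Bool} (h9 : s 9 = List.replicate β true)
    (h12 : s 12 = []) (h15 : s 15 = []) (h18 : s 18 = []) (hβ : 1 ≤ β) :
    Runs (power r) s (r * (30 * β ^ r + 4) + 1)
      (update s 12 (List.replicate (β ^ r) true)) := by
  induction r with
  | zero => exact ((Runs.push s 12 true).mono (by simp)).congr (by simp [h12])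
  | succ r ih =>
    refine ((ih.seq (runs_mulStep (N := β ^ r) ?_ ?_ ?_ ?_ hβ)).mono ?_).congr ?_
    · simpa
    · simp
    · simpa
    · simpa
    · rw [← pow_succ]
      have : β ^ r ≤ β ^ (r + 1) := Nat.pow_le_pow_right hβ (by omega)
      nlinarith [Nat.mul_le_mul_left r this]
    · rw [← pow_succ]; simp

theorem isDeterministic_mulStep : mulStep.IsDeterministic :=
  ⟨isDeterministic_consume _ fun _ => ⟨isDeterministic_consume _ fun _ => isDeterministic_pushes _,
    isDeterministic_consume _ fun _ => isDeterministic_pushes _⟩,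
    isDeterministic_consume _ fun _ => isDeterministic_pushes _⟩

theorem isDeterministic_power (r : ℕ) : (power r).IsDeterministic := by
  induction r with
  | zero => trivial
  | succ r ih => exact ⟨ih, isDeterministic_mulStep⟩

/-- Prepend zeros to stack `i`, as many as stack 6 says. -/
def padStack (i : ℕ) : Program :=
  .seq (consume 6 fun _ => pushes [(3, true), (i, false)]) (consume 3 fun _ => pushes [(6, true)])

theorem isDeterministic_padStack (i : ℕ) : (padStack i).IsDeterministic :=
  ⟨isDeterministic_consume _ fun _ => isDeterministic_pushes _,
    isDeterministic_consume _ fun _ => isDeterministic_pushes _⟩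

/-- The counter on stack 6 is rebuilt from stack 3, so the same program serves for every sample. -/
theorem runs_padStack {i Z : ℕ} (hi3 : i ≠ 3) (hi6 : i ≠ 6) {s : ℕ → List Bool}
    (h6 : s 6 = List.replicate Z true) (h3 : s 3 = []) :
    Runs (padStack i) s (16 * Z + 3) (update s i (List.replicate Z false ++ s i)) := by
  have h1 := runs_consume_pushes (a := 6) (L := fun _ => [(3, true), (i, false)]) (c := 2)
    (by simp) (by simp [pushed, hi6.symm]) s
  have h2 := fun s => runs_consume_pushes (a := 3) (L := fun _ => [(6, true)]) (c := 1)
    (by simp) (by simp [pushed]) s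
  refine ((h1.seq (h2 _)).mono ?_).congr (funext fun j => ?_)
  · simp [h6, h3, pushed, List.flatMap_replicate, hi3.symm]; omega
  · by_cases j6 : j = 6
    · subst j6; simp [h6, h3, pushed, List.flatMap_replicate, hi3.symm, hi6.symm]
    by_cases j3 : j = 3
    · subst j3; simp [h3, hi3.symm]
    by_cases ji : j = i
    · subst ji; simp [h6, pushed, List.flatMap_replicate, hi3, hi6]
    · simp [pushed, j6, j3, ji]

/-! ## Comparison of binary numbers -/

/-- Replace the top of stack 0 by `b`. -/
def setFlag (b : Bool) : Program := .seq (.pop 0) (.push 0 b)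

theorem runs_setFlag {s : ℕ → List Bool} {c : Bool} (hs : s 0 = [c]) (b : Bool) :
    Runs (setFlag b) s 3 (update s 0 [b]) :=
  ((Runs.pop s 0).seq (Runs.push _ 0 b)).congr (by simp [hs])

theorem binaryValue_nil : binaryValue [] = 0 := rfl

theorem binaryValue_cons (b : Bool) (l : List Bool) :
    binaryValue (b :: l) = b.toNat + 2 * binaryValue l := by
  simp [binaryValue, Nat.ofDigits_cons]

/-- The loop over the bits of stack 1 in `compare`. -/
def compareLow : Program :=
  .loop 1 (.cases 1 .skip
    (.seq (.pop 1) (.cases 2 .skip (.pop 2) (.seq (.pop 2) (setFlag true))))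
    (.seq (.pop 1) (.cases 2 (setFlag false) (.seq (.pop 2) (setFlag false)) (.pop 2))))

/-- The loop over the remaining bits of stack 2 in `compare`. -/
def compareHigh : Program := consume 2 fun b => if b then setFlag true else .skip

/-- Once the first number is exhausted, any remaining digit 1 of the second makes the second larger,
whatever the lower digits said. -/
theorem runs_compareHigh (l : List Bool) (c : Bool) (s : ℕ → List Bool) (h0 : s 0 = [c])
    (h2 : s 2 = l) : Runs compareHigh s (7 * l.length + 1)
      (update (update s 2 []) 0 [c || decide (0 < binaryValue l)]) := by
  induction l generalizing c s with
  | nil =>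
    refine ((Runs.loop_nil h2).mono (by simp)).congr (funext fun j => ?_)
    by_cases j0 : j = 0
    · subst j0; simp [h0, binaryValue_nil]
    · by_cases j2 : j = 2
      · subst j2; simp [h2]
      · simp [j0, j2]
  | cons b l ih =>
    cases b
    · refine ((runs_consume_cons h2 (Runs.skip _) (ih c _ (by simpa) (by simp))).mono
        (by simp; omega)).congr ?_
      simp [binaryValue_cons]
    · refine ((runs_consume_cons (q := fun b => if b then setFlag true else .skip) h2
        (runs_setFlag (c := c) (by simpa) true)
        (ih true _ (by simp) (by simp))).mono (by simp; omega)).congr ?_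
      rw [Function.update_comm (by norm_num : (0 : ℕ) ≠ 2)]
      simp [binaryValue_cons]

/-- Digits arrive least significant first, so the flag `c` is the verdict of the digits already read
and counts only if the remaining parts agree; a later difference overrides it. The unread rest `r`
of the second number is left to `compareHigh`. -/
theorem runs_compareLow (l l' : List Bool) (c : Bool) (s : ℕ → List Bool) (h0 : s 0 = [c])
    (h1 : s 1 = l) (h2 : s 2 = l') : ∃ s' r c', Runs compareLow s (10 * l.length + 1) s' ∧
      s' 0 = [c'] ∧ s' 2 = r ∧ r.length ≤ l'.length ∧ (c' || decide (0 < binaryValue r)) =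
        if binaryValue l = binaryValue l' then c else decide (binaryValue l < binaryValue l') := by
  induction l generalizing l' c s with
  | nil =>
    refine ⟨s, l', c, (Runs.loop_nil h1).mono (by simp), h0, h2, le_rfl, ?_⟩
    rcases Nat.eq_zero_or_pos (binaryValue l') with h | h
    · simp [h, binaryValue_nil]
    · simp [h, binaryValue_nil, h.ne]
  | cons a l ih =>
    have hpop : Runs (.pop 1) s 1 (update s 1 l) := (Runs.pop s 1).congr (by rw [h1]; rfl)
    have hpop' : Runs (.pop 2) (update s 1 l) 1 (update (update s 1 l) 2 l'.tail) :=
      (Runs.pop _ 2).congr (by simp [h2])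
    -- One round: compare the two lowest digits, then apply the induction hypothesis to the tails.
    -- The longest branch takes 6 steps, and entering it takes 4 more, whence 10 per digit.
    have step : ∀ c₁ s₁ t, t ≤ 6 → s₁ 0 = [c₁] → s₁ 1 = l → s₁ 2 = l'.tail →
        Runs (if a then (.cases 2 (setFlag false) (.seq (.pop 2) (setFlag false)) (.pop 2))
          else (.cases 2 .skip (.pop 2) (.seq (.pop 2) (setFlag true)))) (update s 1 l) t s₁ →
        (c₁ = if a.toNat = l'.head?.elim 0 Bool.toNat then c
          else decide (a.toNat < l'.head?.elim 0 Bool.toNat)) →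
        ∃ s' r c', Runs compareLow s (10 * (a :: l).length + 1) s' ∧
          s' 0 = [c'] ∧ s' 2 = r ∧ r.length ≤ l'.length ∧ (c' || decide (0 < binaryValue r)) =
          if binaryValue (a :: l) = binaryValue l' then c
          else decide (binaryValue (a :: l) < binaryValue l') := by
      intro c₁ s₁ t ht e0 e1 e2 hrun hc
      obtain ⟨s', r, c', hs', f0, f2, fr, fc⟩ := ih l'.tail c₁ s₁ e0 e1 e2
      refine ⟨s', r, c', ?_, f0, f2, fr.trans (by simp), ?_⟩
      · cases a
        · exact (Runs.loop_cons h1 (.cases_false h1 (hpop.seq hrun)) hs').mono (by simp; omega)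
        · exact (Runs.loop_cons h1 (.cases_true h1 (hpop.seq hrun)) hs').mono (by simp; omega)
      · rw [fc, hc, binaryValue_cons]
        -- An exhausted second number keeps supplying the digit 0.
        have hl' : binaryValue l' = l'.head?.elim 0 Bool.toNat + 2 * binaryValue l'.tail := by
          cases l' <;> simp [binaryValue_cons, binaryValue_nil]
        have hb : l'.head?.elim 0 Bool.toNat ≤ 1 := by
          rcases l' with _ | ⟨_ | _, _⟩ <;> simp
        have ha : a.toNat ≤ 1 := by cases a <;> simp
        rw [hl']
        generalize l'.head?.elim 0 Bool.toNat = b at hb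
        generalize a.toNat = a at ha
        split_ifs <;> first | omega | rfl | (rw [decide_eq_decide]; omega)
    rcases a with _ | _ <;> rcases l' with _ | ⟨_ | _, l'⟩
    · exact step c _ 2 (by norm_num) (by simpa) (by simp) (by simpa)
        (.cases_nil (by simpa) (Runs.skip _)) (by simp)
    · exact step c _ 2 (by norm_num) (by simpa) (by simp) (by simp)
        (.cases_false (by simpa using h2) hpop') (by simp)
    · exact step true _ 6 (by norm_num) (by simp) (by simp) (by simp)
        (.cases_true (by simpa using h2) (hpop'.seq (runs_setFlag (c := c) (by simpa) _)))
        (by simp)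
    · exact step false _ 4 (by norm_num) (by simp) (by simp) (by simpa)
        (.cases_nil (by simpa) (runs_setFlag (c := c) (by simpa) _)) (by simp)
    · exact step false _ 6 (by norm_num) (by simp) (by simp) (by simp)
        (.cases_false (by simpa using h2) (hpop'.seq (runs_setFlag (c := c) (by simpa) _)))
        (by simp)
    · exact step c _ 2 (by norm_num) (by simpa) (by simp) (by simp)
        (.cases_true (by simpa using h2) hpop') (by simp)

/-- Write on stack 0 whether the binary number on stack 1 is less than that on stack 2. -/
def compare : Program := .seq (.push 0 false) (.seq compareLow compareHigh)

theorem isDeterministic_compare : compare.IsDeterministic := by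
  refine ⟨trivial, ?_, isDeterministic_consume _ ?_⟩
  · simp [compareLow, Program.IsDeterministic, setFlag]
  · rintro (_ | _) <;> simp [Program.IsDeterministic, setFlag]

theorem runs_compare {s : ℕ → List Bool} (h0 : s 0 = []) :
    ∃ s', Runs compare s (10 * (s 1).length + 7 * (s 2).length + 5) s' ∧
      s' 0 = [decide (binaryValue (s 1) < binaryValue (s 2))] := by
  obtain ⟨s', r, c', h, f0, f2, fr, fc⟩ := runs_compareLow (s 1) (s 2) false (update s 0 [false])
    (by simp) (by simp) (by simp)
  have hpush : Runs (.push 0 false) s 1 (update s 0 [false]) :=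
    (Runs.push s 0 false).congr (by rw [h0])
  refine ⟨_, (hpush.seq (h.seq (runs_compareHigh r c' s' f0 f2))).mono (by omega), ?_⟩
  rw [Function.update_self, fc]
  split_ifs with h
  · simp [h]
  · rfl

/-! ## The initial and final phases of the reduction -/

/-- From unary `k`, `E` and `D` on stacks 0, 1, 2, compute `Z = (k + K₀) ^ r` on stack 6, and
`Z + (k + 1)`, `C E` and `D` on stacks 20, 21, 22. -/
def learnerSetup (K₀ r C : ℕ) : Program :=
  .seq (consume 0 fun _ => pushes [(9, true), (20, true)]) <|
  .seq (pushes ((20, true) :: List.replicate K₀ (9, true))) <|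
  .seq (power r) <|
  .seq (consume 12 fun _ => pushes [(6, true), (20, true)]) <|
  .seq (consume 1 fun _ => pushes (List.replicate C (21, true)))
    (consume 2 fun _ => pushes [(22, true)])

theorem isDeterministic_learnerSetup (K₀ r C : ℕ) : (learnerSetup K₀ r C).IsDeterministic :=
  ⟨isDeterministic_consume _ fun _ => isDeterministic_pushes _, isDeterministic_pushes _,
    isDeterministic_power r, isDeterministic_consume _ fun _ => isDeterministic_pushes _,
    isDeterministic_consume _ fun _ => isDeterministic_pushes _,
    isDeterministic_consume _ fun _ => isDeterministic_pushes _⟩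

/-- The simulated learner will own the stacks from 20 on; the counter on stack 6 and the empty stack
3 are what `padStack` needs below them. The second parameter is scaled by `C` because the
distribution has to be learned `C` times more accurately than the parity. -/
theorem runs_learnerSetup {K₀ : ℕ} (hK₀ : 1 ≤ K₀) (r C k E D : ℕ) :
    ∃ s', Runs (learnerSetup K₀ r C) (Memory.initial [unary k, unary E, unary D]).stack
      (9 * k + 2 * K₀ + r * (30 * (k + K₀) ^ r + 4) + 9 * (k + K₀) ^ r + E * (2 * C + 5) +
        7 * D + 20) s' ∧
      (∀ i, s' (i + 20) =
        (Memory.initial [unary ((k + K₀) ^ r + (k + 1)), unary (C * E), unary D]).stack i) ∧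
      s' 0 = [] ∧ s' 1 = [] ∧ s' 3 = [] ∧ s' 6 = unary ((k + K₀) ^ r) := by
  set s := (Memory.initial [unary k, unary E, unary D]).stack with hs
  have h1 := runs_consume_pushes (a := 0) (L := fun _ => [(9, true), (20, true)]) (c := 2)
    (by simp) (by simp [pushed]) s
  have h2 := fun s => runs_pushes ((20, true) :: List.replicate K₀ (9, true)) s
  have h3 := fun s => runs_power (β := k + K₀) (s := s) r
  have h4 := fun s => runs_consume_pushes (a := 12) (L := fun _ => [(6, true), (20, true)]) (c := 2)
    (by simp) (by simp [pushed]) s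
  have h5 := fun s => runs_consume_pushes (a := 1) (L := fun _ => List.replicate C (21, true))
    (c := C) (by simp) (by simp) s
  have h6 := fun s => runs_consume_pushes (a := 2) (L := fun _ => [(22, true)]) (c := 1)
    (by simp) (by simp [pushed]) s
  refine ⟨_, (h1.seq <| (h2 _).seq <| (h3 _ ?_ ?_ ?_ ?_ ?_).seq <| (h4 _).seq <| (h5 _).seq
    (h6 _)).mono ?_, ?_, ?_, ?_, ?_, ?_⟩
  · simp [hs, Memory.initial, pushed, List.flatMap_replicate, unary]; omega
  · simp [hs, Memory.initial, pushed, List.flatMap_replicate, unary]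
  · simp [hs, Memory.initial, pushed, List.flatMap_replicate, unary]
  · simp [hs, Memory.initial, pushed, List.flatMap_replicate, unary]
  · omega
  · simp [hs, Memory.initial, pushed, List.flatMap_replicate, unary]
    linarith
  · rintro (_ | _ | _ | i)
    · simp [hs, Memory.initial, pushed, List.flatMap_replicate, unary]
      rw [← List.replicate_succ, List.replicate_append_replicate]
    · simp [hs, Memory.initial, pushed, List.flatMap_replicate, unary]
      exact mul_comm _ _
    · simp [hs, Memory.initial, pushed, List.flatMap_replicate, unary]
    · simp [hs, Memory.initial, pushed, List.flatMap_replicate, unary]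
  all_goals simp [hs, Memory.initial, pushed, List.flatMap_replicate, unary]

/-- Move the content of stack 20 to stack 0. -/
def learnerFinish : Program :=
  .seq (consume 20 fun b => pushes [(1, b)]) (consume 1 fun b => pushes [(0, b)])

theorem isDeterministic_learnerFinish : learnerFinish.IsDeterministic :=
  ⟨isDeterministic_consume _ fun _ => isDeterministic_pushes _,
    isDeterministic_consume _ fun _ => isDeterministic_pushes _⟩

theorem runs_learnerFinish {s : ℕ → List Bool} (h0 : s 0 = []) (h1 : s 1 = []) :
    ∃ s', Runs learnerFinish s (14 * (s 20).length + 3) s' ∧ s' 0 = s 20 := by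
  have hr := runs_consume_pushes (a := 20) (L := fun b => [(1, b)]) (c := 1)
    (by simp) (by simp [pushed]) s
  have hr' := fun s => runs_consume_pushes (a := 1) (L := fun b => [(0, b)]) (c := 1)
    (by simp) (by simp [pushed]) s
  refine ⟨_, (hr.seq (hr' _)).mono ?_, ?_⟩
  · simp [pushed, h1]; omega
  · simp [pushed, h0, h1]

/-- From strings `w` and `x` on stacks 0 and 1, prepare two inputs of an evaluator on the stacks
`3 i + 1` and `3 i + 2`: the string `w`, the points `0 ⋯ 0 x 0` and `0 ⋯ 0 x 1` and the precision
`k + m₀`, where `k` is the length of `x` and there are `(k + K₀) ^ r` zeros in front of `x`. -/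
def hypothesisSetup (K₀ r m₀ : ℕ) : Program :=
  .seq (consume 1 fun b => pushes [(3, b)]) <|
  .seq (consume 0 fun b => pushes [(6, b)]) <|
  .seq (pushes ([(4, false), (5, true)] ++ (List.replicate K₀ (9, true) ++
    (List.replicate m₀ (7, true) ++ List.replicate m₀ (8, true))))) <|
  .seq (consume 3 fun b => pushes [(4, b), (5, b), (9, true), (7, true), (8, true)]) <|
  .seq (consume 6 fun b => pushes [(1, b), (2, b)]) <|
  .seq (power r) (consume 12 fun _ => pushes [(4, false), (5, false)])

theorem isDeterministic_hypothesisSetup (K₀ r m₀ : ℕ) :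
    (hypothesisSetup K₀ r m₀).IsDeterministic :=
  ⟨isDeterministic_consume _ fun _ => isDeterministic_pushes _,
    isDeterministic_consume _ fun _ => isDeterministic_pushes _, isDeterministic_pushes _,
    isDeterministic_consume _ fun _ => isDeterministic_pushes _,
    isDeterministic_consume _ fun _ => isDeterministic_pushes _,
    isDeterministic_power r, isDeterministic_consume _ fun _ => isDeterministic_pushes _⟩

/-- Moving a string between stacks reverses it, so `x` and `w` pass through stacks 3 and 6 to arrive
in their original order; this also clears stacks 0 and 1. The points are built from the back: label
first, then `x`, then the zeros. -/
theorem runs_hypothesisSetup {K₀ : ℕ} (hK₀ : 1 ≤ K₀) (r m₀ : ℕ) (w x : List Bool) :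
    ∃ s', Runs (hypothesisSetup K₀ r m₀) (Memory.initial [w, x]).stack
      (22 * x.length + 16 * w.length + 2 * K₀ + 4 * m₀ +
        r * (30 * (x.length + K₀) ^ r + 4) + 9 * (x.length + K₀) ^ r + 20) s' ∧
      (∀ i, s' (3 * i + 1) = (Memory.initial [w, List.replicate ((x.length + K₀) ^ r) false ++
        (x ++ [false]), unary (x.length + m₀)]).stack i) ∧
      (∀ i, s' (3 * i + 2) = (Memory.initial [w, List.replicate ((x.length + K₀) ^ r) false ++
        (x ++ [true]), unary (x.length + m₀)]).stack i) ∧ s' 0 = [] := by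
  set s := (Memory.initial [w, x]).stack with hs
  have h1 := runs_consume_pushes (a := 1) (L := fun b => [(3, b)]) (c := 1)
    (by simp) (by simp [pushed]) s
  have h2 := fun s => runs_consume_pushes (a := 0) (L := fun b => [(6, b)]) (c := 1)
    (by simp) (by simp [pushed]) s
  have h3 := fun s => runs_pushes ([(4, false), (5, true)] ++ (List.replicate K₀ (9, true) ++
    (List.replicate m₀ (7, true) ++ List.replicate m₀ (8, true)))) s
  have h4 := fun s => runs_consume_pushes (a := 3)
    (L := fun b => [(4, b), (5, b), (9, true), (7, true), (8, true)]) (c := 5)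
    (by simp) (by simp [pushed]) s
  have h5 := fun s => runs_consume_pushes (a := 6) (L := fun b => [(1, b), (2, b)]) (c := 2)
    (by simp) (by simp [pushed]) s
  have h6 := fun s => runs_power (β := x.length + K₀) (s := s) r
  have h7 := fun s => runs_consume_pushes (a := 12) (L := fun _ => [(4, false), (5, false)])
    (c := 2) (by simp) (by simp [pushed]) s
  refine ⟨_, (h1.seq <| (h2 _).seq <| (h3 _).seq <| (h4 _).seq <| (h5 _).seq <|
    (h6 _ ?_ ?_ ?_ ?_ ?_).seq (h7 _)).mono ?_, ?_, ?_, ?_⟩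
  · simp [hs, Memory.initial, pushed]
  · simp [hs, Memory.initial, pushed]
  · simp [hs, Memory.initial, pushed]
  · simp [hs, Memory.initial, pushed]
  · omega
  · simp [hs, Memory.initial, pushed]
    linarith
  · rintro (_ | _ | _ | i)
    · simp [hs, Memory.initial, pushed, List.flatMap_replicate, unary]
    · simp [hs, Memory.initial, pushed, List.flatMap_replicate, unary]
    · simp [hs, Memory.initial, pushed, List.flatMap_replicate, unary]
    · generalize hj : 3 * (i + 1 + 1 + 1) + 1 = j
      have : j ≠ 0 ∧ j ≠ 1 ∧ j ≠ 2 ∧ j ≠ 3 ∧ j ≠ 4 ∧ j ≠ 5 ∧ j ≠ 6 ∧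
          j ≠ 7 ∧ j ≠ 8 ∧ j ≠ 9 ∧ j ≠ 12 ∧ j ≠ 15 ∧ j ≠ 18 := by omega
      simp [this, hs, Memory.initial, pushed, List.flatMap_replicate, unary]
      rw [List.getElem?_eq_none (by simp; omega)]; rfl
  · rintro (_ | _ | _ | i)
    · simp [hs, Memory.initial, pushed, List.flatMap_replicate, unary]
    · simp [hs, Memory.initial, pushed, List.flatMap_replicate, unary]
    · simp [hs, Memory.initial, pushed, List.flatMap_replicate, unary]
    · generalize hj : 3 * (i + 1 + 1 + 1) + 2 = j
      have : j ≠ 0 ∧ j ≠ 1 ∧ j ≠ 2 ∧ j ≠ 3 ∧ j ≠ 4 ∧ j ≠ 5 ∧ j ≠ 6 ∧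
          j ≠ 7 ∧ j ≠ 8 ∧ j ≠ 9 ∧ j ≠ 12 ∧ j ≠ 15 ∧ j ≠ 18 := by omega
      simp [this, hs, Memory.initial, pushed, List.flatMap_replicate, unary]
      rw [List.getElem?_eq_none (by simp; omega)]; rfl
  · simp [hs, Memory.initial, pushed, List.flatMap_replicate]

/-! ## A local circuit for noisy parities -/

/-- The distribution on `Z + m` bits of `Z` zeros followed by a sample of `P`. -/
noncomputable def zeroPad (Z : ℕ) {m : ℕ} (P : Bits m → ℝ) : Bits (Z + m) → ℝ := fun x =>
  if ∀ i : Fin Z, x (Fin.castAdd m i) = false then P fun i => x (Fin.natAdd Z i) else 0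

theorem zeroPad_append {Z m : ℕ} (P : Bits m → ℝ) (a : Bits Z) (z : Bits m) :
    zeroPad Z P (Fin.append a z) = if a = fun _ => false then P z else 0 := by
  simp [zeroPad, funext_iff]

theorem zeroPad_nonneg {Z m : ℕ} {P : Bits m → ℝ} (hP : ∀ x, 0 ≤ P x) (x : Bits (Z + m)) :
    0 ≤ zeroPad Z P x := by
  unfold zeroPad; split_ifs; exacts [hP _, le_rfl]

theorem sum_bits_add {Z m : ℕ} (F : Bits (Z + m) → ℝ) :
    ∑ x, F x = ∑ a : Bits Z, ∑ z : Bits m, F (Fin.append a z) := by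
  rw [← (Fin.appendEquiv Z m).sum_comp, Fintype.sum_prod_type]
  rfl

/-- Drawing from the padded distribution amounts to drawing from `P` and prepending zeros; this is
the condition on samples in `successProb_le_simulate`. -/
theorem sum_zeroPad_mul {Z m : ℕ} (P : Bits m → ℝ) (F : Bits (Z + m) → ℝ) :
    ∑ x, zeroPad Z P x * F x = ∑ z, P z * F (Fin.append (fun _ => false) z) := by
  rw [sum_bits_add, Fintype.sum_eq_single (fun _ => false)]
  · simp [zeroPad_append]
  · intro a ha
    simp [zeroPad_append, ha]

theorem ofFn_append_false {Z m : ℕ} (z : Bits m) :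
    List.ofFn (Fin.append (fun _ : Fin Z => false) z) = List.replicate Z false ++ List.ofFn z := by
  rw [List.ofFn_fin_append, List.ofFn_const]

theorem sum_bits_succ {k : ℕ} (F : Bits (k + 1) → ℝ) :
    ∑ z, F z = ∑ x : Bits k, ∑ b : Bool, F (Fin.snoc x b) := by
  rw [← (Fin.snocEquiv fun _ : Fin (k + 1) => Bool).sum_comp, Fintype.sum_prod_type,
    Finset.sum_comm]
  rfl

theorem noisyParity_snoc {k : ℕ} (η : ℝ) (s x : Bits k) (b : Bool) :
    noisyParity η s (Fin.snoc x b) = (1 / 2 ^ k) * if b = parity s x then 1 - η else η := by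
  simp [noisyParity]

theorem noisyParity_nonneg {k : ℕ} {η : ℝ} (h0 : 0 ≤ η) (h1 : η ≤ 1) (s : Bits k)
    (z : Bits (k + 1)) : 0 ≤ noisyParity η s z := by
  unfold noisyParity
  split_ifs <;> positivity

theorem sum_noisyParity {k : ℕ} (η : ℝ) (s : Bits k) : ∑ z, noisyParity η s z = 1 := by
  rw [sum_bits_succ]
  have : ∀ x : Bits k, ∑ b : Bool, noisyParity η s (Fin.snoc x b) = 1 / 2 ^ k := by
    intro x
    rw [Fintype.sum_bool, noisyParity_snoc, noisyParity_snoc]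
    cases parity s x <;> simp <;> ring
  rw [Finset.sum_congr rfl fun x _ => this x]
  simp

theorem zeroPad_noisyParity_mem_stdSimplex {k : ℕ} {η : ℝ} (h0 : 0 ≤ η) (h1 : η ≤ 1) (s : Bits k)
    (Z : ℕ) : zeroPad Z (noisyParity η s) ∈ stdSimplex ℝ (Bits (Z + (k + 1))) := by
  refine ⟨zeroPad_nonneg (noisyParity_nonneg h0 h1 s), ?_⟩
  simpa [sum_noisyParity] using sum_zeroPad_mul (Z := Z) (noisyParity η s) fun _ => 1

/-- The layer with a single gate. -/
def Layer.single {n : ℕ} (g : Gate n) : Layer n := ⟨[g], List.pairwise_singleton _ g⟩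

/-- The layer without gates. -/
def Layer.idle (n : ℕ) : Layer n := ⟨[], List.Pairwise.nil⟩

theorem foldl_idle {n : ℕ} (m : ℕ) (ψ : Bits n → ℂ) :
    (List.replicate m (Layer.idle n)).foldl (fun φ L => L.apply φ) ψ = ψ := by
  induction m with
  | zero => rfl
  | succ m ih => rw [List.replicate_succ, List.foldl_cons]; exact ih

/-- The amplitudes of a noise bit of rate `η`. -/
noncomputable def noiseAmplitude (η : ℝ) (b : Bool) : ℂ :=
  ((if b then Real.sqrt η else Real.sqrt (1 - η) : ℝ) : ℂ)

/-- A rotation that prepares a noise bit. -/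
noncomputable def noiseGate (η : ℝ) : Matrix Bool Bool ℂ := fun a b =>
  if b then (if a then noiseAmplitude η false else -noiseAmplitude η true) else noiseAmplitude η a

theorem noiseGate_mem_unitaryGroup {η : ℝ} (h0 : 0 ≤ η) (h1 : η ≤ 1) :
    noiseGate η ∈ Matrix.unitaryGroup Bool ℂ := by
  have hη : ((Real.sqrt η : ℝ) : ℂ) * (Real.sqrt η : ℝ) = (η : ℂ) := by
    rw [← Complex.ofReal_mul, Real.mul_self_sqrt h0]
  have hη' : ((Real.sqrt (1 - η) : ℝ) : ℂ) * (Real.sqrt (1 - η) : ℝ) = 1 - (η : ℂ) := by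
    rw [← Complex.ofReal_mul, Real.mul_self_sqrt (by linarith)]; push_cast; ring
  rw [Matrix.mem_unitaryGroup_iff]
  ext a b
  cases a <;> cases b <;>
    simp [Matrix.mul_apply, noiseGate, noiseAmplitude, hη, hη', mul_comm]

/-- The two-qubit gate that maps `|c, 0⟩` to `2 ^ (-1/2) ∑ a, |a, c + s a⟩`. -/
noncomputable def parityGate (s : Bool) : Matrix (Bool × Bool) (Bool × Bool) ℂ := fun p q =>
  if q.1 = xor p.2 (s && p.1) then (if p.1 && q.2 then -1 else 1) * ((1 / Real.sqrt 2 : ℝ) : ℂ)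
  else 0

/-- The gate is a swap, then a Hadamard gate on the first qubit, then, if `s = 1`, a CNOT from the
first to the second. -/
theorem parityGate_mem_unitaryGroup (s : Bool) :
    parityGate s ∈ Matrix.unitaryGroup (Bool × Bool) ℂ := by
  have h2 : ((Real.sqrt 2 : ℝ) : ℂ)⁻¹ * ((Real.sqrt 2 : ℝ) : ℂ)⁻¹ = 1 / 2 := by
    rw [← mul_inv, ← Complex.ofReal_mul, Real.mul_self_sqrt (by norm_num)]; norm_num
  rw [Matrix.mem_unitaryGroup_iff]
  ext ⟨a, b⟩ ⟨a', b'⟩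
  cases s <;> cases a <;> cases b <;> cases a' <;> cases b' <;>
    simp [Matrix.mul_apply, Fintype.sum_prod_type, parityGate, h2] <;> norm_num

/-- The parity of the first `j` bits of the masked string `s z`, where `s` is placed at
position `Z`. -/
def prefixParity {k : ℕ} (Z : ℕ) (s : Bits k) (z : Bits (Z + (k + 1))) (j : ℕ) : Bool :=
  (∑ i : Fin k, if (i : ℕ) < j then (s i && z (Fin.natAdd Z i.castSucc)).toNat else 0).bodd

theorem prefixParity_zero {k : ℕ} (Z : ℕ) (s : Bits k) (z : Bits (Z + (k + 1))) :
    prefixParity Z s z 0 = false := by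
  simp [prefixParity]

theorem prefixParity_succ {k : ℕ} (Z : ℕ) (s : Bits k) (z : Bits (Z + (k + 1))) (j : Fin k) :
    prefixParity Z s z (j + 1) =
      xor (prefixParity Z s z j) (s j && z (Fin.natAdd Z j.castSucc)) := by
  have : ∀ i : Fin k, (if (i : ℕ) < j + 1 then (s i && z (Fin.natAdd Z i.castSucc)).toNat else 0) =
      (if (i : ℕ) < j then (s i && z (Fin.natAdd Z i.castSucc)).toNat else 0) +
      if i = j then (s i && z (Fin.natAdd Z i.castSucc)).toNat else 0 := by
    intro i
    rcases lt_trichotomy i j with h | rfl | h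
    · have h' : (i : ℕ) < j := h
      simp [h.ne, h', Nat.lt_succ_of_lt h']
    · simp
    · have h' : (j : ℕ) < i := h
      simp [h.ne', h'.not_gt, show ¬ (i : ℕ) < j + 1 by omega]
  unfold prefixParity
  rw [Finset.sum_congr rfl fun i _ => this i, Finset.sum_add_distrib, Nat.bodd_add]
  congr 1
  simp only [Finset.sum_ite_eq', Finset.mem_univ, if_true]
  cases (s j && z (Fin.natAdd Z j.castSucc)) <;> rfl

/-- The gate at positions `j`, `j + 1` of the block therefore leaves the parity of the first `j`
bits alone. -/
theorem prefixParity_congr {k : ℕ} (Z : ℕ) (s : Bits k) {z z' : Bits (Z + (k + 1))} {j : ℕ}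
    (h : ∀ i : Fin (k + 1), (i : ℕ) < j → z (Fin.natAdd Z i) = z' (Fin.natAdd Z i)) :
    prefixParity Z s z j = prefixParity Z s z' j := by
  unfold prefixParity
  congr 1
  refine Finset.sum_congr rfl fun i _ => ?_
  split_ifs with hi
  · rw [h _ (by simpa using hi)]
  · rfl

/-- The state after the first `j` parity gates. -/
noncomputable def ladderState {k : ℕ} (η : ℝ) (s : Bits k) (Z : ℕ) (j : Fin (k + 1)) :
    Bits (Z + (k + 1)) → ℂ := fun z =>
  if ∀ p : Fin (Z + (k + 1)), (p : ℕ) < Z ∨ Z + j < p → z p = false then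
    ((1 / Real.sqrt 2 : ℝ) : ℂ) ^ (j : ℕ) *
      noiseAmplitude η (xor (z (Fin.natAdd Z j)) (prefixParity Z s z j))
  else 0

theorem noiseGate_apply_zero {k : ℕ} {η : ℝ} (h0 : 0 ≤ η) (h1 : η ≤ 1) (s : Bits k) (Z : ℕ) :
    (Gate.one (Fin.natAdd Z 0) ⟨noiseGate η, noiseGate_mem_unitaryGroup h0 h1⟩).apply
      (fun x : Bits (Z + (k + 1)) => if x = fun _ => false then 1 else 0) =
      ladderState η s Z 0 := by
  funext z
  have h : ∀ b, (update z (Fin.natAdd Z 0) b = fun _ => false) ↔ b = false ∧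
      ∀ p : Fin (Z + (k + 1)), (p : ℕ) < Z ∨ Z + ((0 : Fin (k + 1)) : ℕ) < p → z p = false := by
    intro b
    rw [Function.update_eq_iff]
    refine and_congr Iff.rfl (forall_congr' fun p => ?_)
    have : p ≠ Fin.natAdd Z 0 ↔ (p : ℕ) < Z ∨ Z + ((0 : Fin (k + 1)) : ℕ) < p := by
      rw [Ne, Fin.ext_iff]; simp
    rw [this]
  simp only [Gate.apply, ladderState, h, Fintype.sum_bool]
  simp [prefixParity_zero, noiseGate]

/-- The amplitude at `z` is a sum over the previous values `(c, w)` of the two qubits. Only `w = 0`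
and `c = z_{j+1} + s_j z_j` contribute, and adding to this `c` the parity of the first `j` bits
gives `z_{j+1}` plus the parity of the first `j + 1` bits: the noise bit is unchanged. -/
theorem parityGate_apply_ladderState {k : ℕ} (η : ℝ) (s : Bits k) (Z : ℕ) (j : Fin k) :
    (Gate.two (Fin.natAdd Z j.castSucc) (Fin.natAdd Z j.succ) (by simp [add_assoc])
      ⟨parityGate (s j), parityGate_mem_unitaryGroup _⟩).apply (ladderState η s Z j.castSucc) =
      ladderState η s Z j.succ := by
  funext z
  have hne : Fin.natAdd Z j.castSucc ≠ Fin.natAdd Z j.succ := by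
    rw [Ne, Fin.ext_iff]; simp
  have h : ∀ c w, (∀ p : Fin (Z + (k + 1)), (p : ℕ) < Z ∨ Z + (j.castSucc : ℕ) < p →
      update (update z (Fin.natAdd Z j.castSucc) c) (Fin.natAdd Z j.succ) w p = false) ↔
      w = false ∧ ∀ p : Fin (Z + (k + 1)), (p : ℕ) < Z ∨ Z + (j.succ : ℕ) < p → z p = false := by
    -- The qubit at `Z + j + 1` has not been used before, so its old value must be 0, while the old
    -- value at `Z + j` is unconstrained.
    intro c w
    constructor
    · refine fun h => ⟨by simpa using h (Fin.natAdd Z j.succ) (by simp), fun p hp => ?_⟩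
      have h1 : p ≠ Fin.natAdd Z j.castSucc := by
        rw [Ne, Fin.ext_iff]; simp at hp ⊢; omega
      have h2 : p ≠ Fin.natAdd Z j.succ := by
        rw [Ne, Fin.ext_iff]; simp at hp ⊢; omega
      simpa [h1, h2] using h p (by simp at hp ⊢; omega)
    · rintro ⟨rfl, h⟩ p hp
      by_cases h2 : p = Fin.natAdd Z j.succ
      · simp [h2]
      · have h1 : p ≠ Fin.natAdd Z j.castSucc := by
          rw [Ne, Fin.ext_iff]; simp at hp ⊢; omega
        have h3 : (p : ℕ) ≠ Z + (j + 1) := by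
          rw [Fin.ext_iff] at h2; simpa using h2
        simpa [h1, h2] using h p (by simp at hp ⊢; omega)
  have hpar : ∀ c w, prefixParity Z s
      (update (update z (Fin.natAdd Z j.castSucc) c) (Fin.natAdd Z j.succ) w) j =
      prefixParity Z s z j := by
    intro c w
    refine prefixParity_congr Z s fun i hi => ?_
    have h1 : Fin.natAdd Z i ≠ Fin.natAdd Z j.castSucc := by
      rw [Ne, Fin.ext_iff]; simp; omega
    have h2 : Fin.natAdd Z i ≠ Fin.natAdd Z j.succ := by
      rw [Ne, Fin.ext_iff]; simp; omega
    simp [h1, h2]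
  simp only [Gate.apply, ladderState, h, Fintype.sum_prod_type, Fintype.sum_bool]
  simp only [Fin.val_castSucc, hpar, Fin.val_succ, prefixParity_succ, Function.update_of_ne hne, Function.update_self]
  by_cases hz : ∀ p : Fin (Z + (k + 1)), (p : ℕ) < Z ∨ Z + (j + 1 : ℕ) < p → z p = false
  · simp only [parityGate, eq_true hz]
    cases z (Fin.natAdd Z j.castSucc) <;> cases z (Fin.natAdd Z j.succ) <;> cases s j <;>
      cases prefixParity Z s z j <;> simp [pow_succ] <;> ring
  · simp [eq_false hz]

/-- The `k` factors `1/√2` square to `1 / 2 ^ k`, and the noise amplitude squares to `1 - η` or `η`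
according to whether the last bit equals the parity. -/
theorem norm_ladderState_last_sq {k : ℕ} {η : ℝ} (h0 : 0 ≤ η) (h1 : η ≤ 1) (s : Bits k) (Z : ℕ)
    (z : Bits (Z + (k + 1))) :
    ‖ladderState η s Z (Fin.last k) z‖ ^ 2 = zeroPad Z (noisyParity η s) z := by
  have hz : (∀ p : Fin (Z + (k + 1)), (p : ℕ) < Z ∨ Z + (Fin.last k : ℕ) < p → z p = false) ↔
      ∀ i : Fin Z, z (Fin.castAdd (k + 1) i) = false := by
    constructor
    · exact fun h i => h _ (by simp)
    · intro h p hp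
      have : (p : ℕ) < Z := by have := p.2; simp at hp; omega
      exact h ⟨p, this⟩
  have hpar : prefixParity Z s z k = parity s fun i => z (Fin.natAdd Z i.castSucc) := by
    simp [prefixParity, parity]
  have hsq : ‖((1 / Real.sqrt 2 : ℝ) : ℂ)‖ ^ 2 = 1 / 2 := by
    rw [Complex.norm_real, Real.norm_eq_abs, sq_abs, div_pow, Real.sq_sqrt (by norm_num)]
    norm_num
  simp only [ladderState, zeroPad, hz, noisyParity]
  split_ifs with _ hp
  · rw [norm_mul, mul_pow, norm_pow, ← pow_mul, mul_comm (Fin.last k : ℕ), pow_mul, hsq,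
      Fin.val_last, hpar, hp]
    simp [noiseAmplitude, sub_nonneg.2 h1]
  · have : xor (z (Fin.natAdd Z (Fin.last k))) (prefixParity Z s z k) = true := by
      rw [hpar]; revert hp; cases z (Fin.natAdd Z (Fin.last k)) <;>
        cases (parity s fun i => z (Fin.natAdd Z i.castSucc)) <;> simp
    rw [norm_mul, mul_pow, norm_pow, ← pow_mul, mul_comm (Fin.last k : ℕ), pow_mul, hsq,
      Fin.val_last, this]
    simp [noiseAmplitude, h0]
  · simp

/-- Noisy parities of `k` bits, padded with zeros, are output distributions of local circuits of
any depth larger than `k`. -/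
theorem zeroPad_noisyParity_mem_circuitDistributions {k d : ℕ} {η : ℝ} (h0 : 0 ≤ η) (h1 : η ≤ 1)
    (s : Bits k) (Z : ℕ) (hd : k + 1 ≤ d) :
    zeroPad Z (noisyParity η s) ∈ circuitDistributions (Z + (k + 1)) d := by
  refine ⟨zeroPad_noisyParity_mem_stdSimplex h0 h1 s Z, ?_⟩
  -- One layer for the noise bit and one for each of the first `j` parity gates.
  have key : ∀ j : Fin (k + 1), ∃ C : List (Layer (Z + (k + 1))), C.length = j + 1 ∧
      C.foldl (fun φ L => L.apply φ) (fun x => if x = fun _ => false then 1 else 0) =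
        ladderState η s Z j := by
    intro j
    induction j using Fin.induction with
    | zero =>
      exact ⟨[Layer.single (.one (Fin.natAdd Z 0) ⟨noiseGate η, noiseGate_mem_unitaryGroup h0 h1⟩)],
        rfl, noiseGate_apply_zero h0 h1 s Z⟩
    | succ j ih =>
      obtain ⟨C, hC, hψ⟩ := ih
      refine ⟨C ++ [Layer.single (.two (Fin.natAdd Z j.castSucc) (Fin.natAdd Z j.succ)
        (by simp [add_assoc]) ⟨parityGate (s j), parityGate_mem_unitaryGroup _⟩)],
        by simp [hC], ?_⟩
      rw [List.foldl_append, hψ]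
      exact parityGate_apply_ladderState η s Z j
  obtain ⟨C, hC, hψ⟩ := key (Fin.last k)
  -- Idle layers bring the depth to exactly `d`.
  refine ⟨⟨C ++ List.replicate (d - (k + 1)) (Layer.idle _), ?_⟩, fun z => ?_⟩
  · rw [List.length_append, hC, List.length_replicate, Fin.val_last]; omega
  · change _ = ‖List.foldl (fun φ L => L.apply φ) (fun x => if x = fun _ => false then 1 else 0)
      (C ++ List.replicate (d - (k + 1)) (Layer.idle _)) z‖ ^ 2
    rw [List.foldl_append, foldl_idle, hψ, norm_ladderState_last_sq h0 h1]

/-! ## From evaluators to hypotheses -/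

/-- The program that evaluates a hypothesis: it runs the evaluator `V` on the points `0 ⋯ 0 x 0` and
`0 ⋯ 0 x 1` and compares the results. -/
def hypothesisProgram (K₀ r m₀ : ℕ) (V : Program) : Program :=
  .seq (hypothesisSetup K₀ r m₀) <| .seq (V.simulate (3 * · + 1) fun _ => .skip) <|
    .seq (V.simulate (3 * · + 2) fun _ => .skip) compare

theorem isDeterministic_hypothesisProgram (K₀ r m₀ : ℕ) {V : Program} (hV : V.IsDeterministic) :
    (hypothesisProgram K₀ r m₀ V).IsDeterministic :=
  ⟨isDeterministic_hypothesisSetup _ _ _, hV.simulate _ _, hV.simulate _ _, isDeterministic_compare⟩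

/-- The runs on stacks `3 i + 1` and `3 i + 2` do not disturb each other and leave their outputs on
stacks 1 and 2, where `compare` reads them. `h₀` and `h₁` allow any heads and qubits, since the
simulation result does not say that the first run ends in the initial quantum state. Each run costs
`3 T`: postprocessing by `skip` counts as one step. -/
theorem outputs_hypothesisProgram {K₀ : ℕ} (hK₀ : 1 ≤ K₀) (r m₀ : ℕ) {V : Program}
    (hV : V.IsDeterministic) {w x o₀ o₁ : List Bool} {T : ℕ}
    (h₀ : ∀ {n : ℕ} (P : Bits n → ℝ) (σ : Memory), σ.stack = (Memory.initial
      [w, List.replicate ((x.length + K₀) ^ r) false ++ (x ++ [false]),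
        unary (x.length + m₀)]).stack → successProb P (· = o₀) T [V] σ = σ.qubits.normSq)
    (h₁ : ∀ {n : ℕ} (P : Bits n → ℝ) (σ : Memory), σ.stack = (Memory.initial
      [w, List.replicate ((x.length + K₀) ^ r) false ++ (x ++ [true]),
        unary (x.length + m₀)]).stack → successProb P (· = o₁) T [V] σ = σ.qubits.normSq) {T' : ℕ}
    (hT' : (22 * x.length + 16 * w.length + 2 * K₀ + 4 * m₀ +
        r * (30 * (x.length + K₀) ^ r + 4) + 9 * (x.length + K₀) ^ r + 20) + 6 * T +
        (10 * o₀.length + 7 * o₁.length + 5) + 3 ≤ T') :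
    Outputs (hypothesisProgram K₀ r m₀ V) [w, x] T'
      (· = [decide (binaryValue o₀ < binaryValue o₁)]) := by
  refine le_antisymm (runProb_le_one (isDeterministic_hypothesisProgram _ _ _ hV) _ _ _ _) ?_
  have hP : ∀ x : Bits 0, (0 : ℝ) ≤ (fun _ => 1) x := fun _ => zero_le_one
  obtain ⟨s, hs, hs₀, hs₁, hs0⟩ := runs_hypothesisSetup hK₀ r m₀ w x
  set tc := 10 * o₀.length + 7 * o₁.length + 5
  set good : List Bool → Prop := (· = [decide (binaryValue o₀ < binaryValue o₁)])
  have hf₀ : Function.Injective (3 * · + 1 : ℕ → ℕ) := fun a b h => by simpa using h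
  have hf₁ : Function.Injective (3 * · + 2 : ℕ → ℕ) := fun a b h => by simpa using h
  have hskip : ∀ (f : ℕ → ℕ) (i : ℕ) (s : ℕ → List Bool),
      Runs .skip s 1 (update s (f i) ([] ++ s (f i))) :=
    fun f i s => (Runs.skip s).congr (by simp)
  have hfinal₁ : ∀ s₁ : ℕ → List Bool, s₁ 0 = [] → s₁ 1 = o₀ → ∀ σ σ',
      Simulates (3 * · + 2) s₁ σ σ' → σ.stack 0 = o₁ →
      σ.qubits.normSq ≤ successProb (fun _ : Bits 0 => 1) good tc [compare] σ' := by
    intro s₁ e0 e1 σ σ' hσ ho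
    have f0 : σ'.stack 0 = [] := by
      rw [hσ.stack_of_notMem 0 (by rintro ⟨i, hi⟩; simp at hi), e0]
    have f1 : σ'.stack 1 = o₀ := by
      rw [hσ.stack_of_notMem 1 (by rintro ⟨i, hi⟩; simp at hi), e1]
    have f2 : σ'.stack 2 = o₁ := by rw [← ho, ← hσ.stack_apply 0]
    obtain ⟨s', hr, hs'⟩ := runs_compare f0
    rw [f1, f2] at hr hs'
    have := hr.le_successProb _ hP good 0 [] σ' rfl
    rw [successProb_nil] at this
    simpa only [hs', good, if_true, hσ.qubits_eq] using this
  have hfinal₀ : ∀ σ σ', Simulates (3 * · + 1) s σ σ' → σ.stack 0 = o₀ →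
      σ.qubits.normSq ≤ successProb (fun _ : Bits 0 => 1) good (3 * T + tc + 1)
        [.seq (V.simulate (3 * · + 2) fun _ => .skip) compare] σ' := by
    intro σ σ' hσ ho
    rw [← hσ.qubits_eq, successProb, mul_comm 3 T]
    -- The memory the second run appears to start from: fresh evaluator inputs, with the heads and
    -- qubits left by the first run.
    let σ₁ : Memory := { σ' with stack := (Memory.initial
      [w, List.replicate ((x.length + K₀) ^ r) false ++ (x ++ [true]), unary (x.length + m₀)]).stack }
    rw [← show _ = σ'.qubits.normSq from h₁ (fun _ : Bits 0 => 1) σ₁ rfl]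
    refine successProb_le_simulate (P' := fun _ : Bits 0 => 1) hP hf₁ (pre := [])
      (fun F => by simp) (fun i s _ => hskip (3 * · + 2) i s) (hfinal₁ σ'.stack ?_ ?_) T [V] σ₁ σ'
      ⟨fun i => ?_, fun j _ => rfl, rfl, rfl⟩
    · rw [hσ.stack_of_notMem 0 (by rintro ⟨i, hi⟩; simp at hi), hs0]
    · rw [← ho, ← hσ.stack_apply 0]
    · rw [hσ.stack_of_notMem _ (by rintro ⟨i', hi⟩; simp at hi; omega), hs₁]
  have hmain := successProb_le_simulate (P := fun _ : Bits 0 => 1) hP hf₀ (pre := [])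
    (pad := fun _ => .skip) (s₀ := s) (tp := 1) (good := (· = o₀)) (good' := good) (fun F => by simp)
    (fun i s _ => hskip (3 * · + 1) i s) hfinal₀ T [V]
    (Memory.initial [w, List.replicate ((x.length + K₀) ^ r) false ++ (x ++ [false]),
      unary (x.length + m₀)]) { Memory.initial [w, x] with stack := s }
    ⟨hs₀, fun j _ => rfl, rfl, rfl⟩
  rw [h₀ _ _ rfl, normSq_initial] at hmain
  have hseq := hs.le_successProb _ hP good (T * (1 + 2) + (3 * T + tc + 1) + 1)
    [.seq (V.simulate (3 * · + 1) fun _ => .skip)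
      (.seq (V.simulate (3 * · + 2) fun _ => .skip) compare)] _ rfl
  exact (hmain.trans (successProb_seq_le hP good _ _ _ _ le_rfl)).trans
    (hseq.trans (successProb_seq_le hP good _ _ _ _ (by omega)))

/-- If the evaluated distribution is close to the padded noisy parity distribution, then the
hypothesis is close to the parity. -/
theorem card_ne_parity_le {k Z m₀ : ℕ} {η : ℝ} {s : Bits k} {Q : Bits (Z + (k + 1)) → ℝ}
    {v : Bits k → Bool → ℝ}
    (hv : ∀ x b, |v x b - Q (Fin.append (fun _ => false) (Fin.snoc x b : Bits (k + 1)))| ≤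
      1 / 2 ^ (k + m₀)) {h : Bits k → Bool} (hh : ∀ x, h x = decide (v x false < v x true)) :
    ((Finset.univ.filter fun x => h x ≠ parity s x).card : ℝ) / 2 ^ k *
      (1 - 2 * η - 2 / 2 ^ m₀) ≤ 2 * tvDist (zeroPad Z (noisyParity η s)) Q := by
  -- At a wrong prediction the approximate values are ordered against the true weights, whose gap is
  -- `(1 - 2η) / 2 ^ k`. The deviations of `Q` at the two labels must make up for this gap, except
  -- for two rounding errors of `1 / 2 ^ (k + m₀)`.
  have hbad : ∀ x, h x ≠ parity s x → 1 / 2 ^ k * (1 - 2 * η - 2 / 2 ^ m₀) ≤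
      ∑ b : Bool, |noisyParity η s (Fin.snoc x b) -
        Q (Fin.append (fun _ => false) (Fin.snoc x b : Bits (k + 1)))| := by
    intro x hx
    have h0 := abs_le.1 (hv x false)
    have h1 := abs_le.1 (hv x true)
    rw [show (1 : ℝ) / 2 ^ (k + m₀) = 1 / 2 ^ k * (1 / 2 ^ m₀) by rw [pow_add]; field_simp] at h0 h1
    rw [Fintype.sum_bool, noisyParity_snoc, noisyParity_snoc]
    rw [show (1 : ℝ) / 2 ^ k * (1 - 2 * η - 2 / 2 ^ m₀) =
      1 / 2 ^ k * (1 - η) - 1 / 2 ^ k * η - 2 * (1 / 2 ^ k * (1 / 2 ^ m₀)) by ring]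
    rw [hh] at hx
    generalize Q (Fin.append (fun _ => false) (Fin.snoc x false : Bits (k + 1))) = q0 at h0 ⊢
    generalize Q (Fin.append (fun _ => false) (Fin.snoc x true : Bits (k + 1))) = q1 at h1 ⊢
    cases hp : parity s x
    · have hlt : v x false < v x true := by simpa [hp] using hx
      simp only [Bool.true_eq_false, if_false, if_true]
      have := le_abs_self (1 / 2 ^ k * (1 - η) - q0)
      have := neg_abs_le (1 / 2 ^ k * η - q1)
      linarith
    · have hlt : v x true ≤ v x false := by simpa [hp] using hx
      simp only [Bool.false_eq_true, if_false, if_true]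
      have := le_abs_self (1 / 2 ^ k * (1 - η) - q1)
      have := neg_abs_le (1 / 2 ^ k * η - q0)
      linarith
  -- Only the points with an all-zero prefix are kept in the total variation sum.
  have htv : ∑ x : Bits k, ∑ b : Bool, |noisyParity η s (Fin.snoc x b) -
      Q (Fin.append (fun _ => false) (Fin.snoc x b : Bits (k + 1)))| ≤
      2 * tvDist (zeroPad Z (noisyParity η s)) Q := by
    rw [← sum_bits_succ fun z => |noisyParity η s z - Q (Fin.append (fun _ => false) z)|, tvDist,
      sum_bits_add (Z := Z) (m := k + 1), ← mul_assoc, show (2 : ℝ) * (1 / 2) = 1 by norm_num, one_mul]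
    refine le_trans (le_of_eq ?_) (Finset.single_le_sum
      (f := fun a : Bits Z => ∑ z : Bits (k + 1), |zeroPad Z (noisyParity η s) (Fin.append a z) -
        Q (Fin.append a z)|)
      (fun a _ => Finset.sum_nonneg fun z _ => abs_nonneg _) (Finset.mem_univ fun _ => false))
    simp [zeroPad_append]
  refine le_trans ?_ htv
  calc _ = ∑ x ∈ Finset.univ.filter fun x => h x ≠ parity s x,
        1 / 2 ^ k * (1 - 2 * η - 2 / 2 ^ m₀) := by
        rw [Finset.sum_const, nsmul_eq_mul]; ring
    _ ≤ ∑ x ∈ Finset.univ.filter fun x => h x ≠ parity s x, ∑ b : Bool,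
          |noisyParity η s (Fin.snoc x b) -
          Q (Fin.append (fun _ => false) (Fin.snoc x b : Bits (k + 1)))| :=
        Finset.sum_le_sum fun x hx => hbad x (Finset.mem_filter.1 hx).2
    _ ≤ _ := Finset.sum_le_sum_of_subset_of_nonneg (Finset.filter_subset _ _)
        fun x _ _ => Finset.sum_nonneg fun b _ => abs_nonneg _

/-! ## The learner for noisy parities -/

/-- The program that learns noisy parities by means of the learner `A` for distributions, which is
given samples padded with zeros. -/
def learnerProgram (K₀ r C : ℕ) (A : Program) : Program :=
  .seq (learnerSetup K₀ r C) (.seq (A.simulate (· + 20) padStack) learnerFinish)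

theorem admits_learnerProgram (K₀ r C : ℕ) {M : Model} {A : Program} (hA : M.Admits A) :
    M.Admits (learnerProgram K₀ r C A) := by
  cases M
  · exact ⟨(isDeterministic_learnerSetup K₀ r C).isClassical,
      Program.IsClassical.simulate _ (fun i => (isDeterministic_padStack i).isClassical) hA,
      isDeterministic_learnerFinish.isClassical⟩
  · trivial

/-- A good output of `A` must still be moved to stack 0, at a cost proportional to its length. The
bound `M + T` on that length is therefore added to the predicate before simulating, and is also made
available in `hgood`. -/
theorem runProb_le_learnerProgram {K₀ : ℕ} (hK₀ : 1 ≤ K₀) (r C : ℕ) (A : Program) {k E D : ℕ}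
    {P : Bits (k + 1) → ℝ} (hP : ∀ z, 0 ≤ P z) {T M T' : ℕ}
    (hn : (k + K₀) ^ r + (k + 1) ≤ M) (hE : C * E ≤ M) (hD : D ≤ M) {good good' : List Bool → Prop}
    (hgood : ∀ l : List Bool, l.length ≤ M + T → good l → good' l)
    (hT' : (9 * k + 2 * K₀ + r * (30 * (k + K₀) ^ r + 4) + 9 * (k + K₀) ^ r + E * (2 * C + 5) +
        7 * D + 20) + T * (16 * (k + K₀) ^ r + 5) + (14 * (M + T) + 3) + 2 ≤ T') :
    runProb A (zeroPad ((k + K₀) ^ r) P)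
      [unary ((k + K₀) ^ r + (k + 1)), unary (C * E), unary D] T good ≤
    runProb (learnerProgram K₀ r C A) P [unary k, unary E, unary D] T' good' := by
  obtain ⟨s, hs, hs20, h0, h1, h3, h6⟩ := runs_learnerSetup hK₀ r C k E D
  have hf : Function.Injective (· + 20 : ℕ → ℕ) := fun a b h => by simpa using h
  have hmem : ∀ j < 20, j ∉ Set.range (· + 20 : ℕ → ℕ) := by
    rintro j hj ⟨i, hi⟩
    simp at hi
    omega
  have hfinal : ∀ σ σ', Simulates (· + 20) s σ σ' →
      (good' (σ.stack 0) ∧ (σ.stack 0).length ≤ M + T) →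
      σ.qubits.normSq ≤ successProb P good' (14 * (M + T) + 3) [learnerFinish] σ' := by
    rintro σ σ' hσ ⟨hg, hl⟩
    obtain ⟨s', hr, hs'⟩ := runs_learnerFinish
      ((hσ.stack_of_notMem 0 (hmem 0 (by norm_num))).trans h0)
      ((hσ.stack_of_notMem 1 (hmem 1 (by norm_num))).trans h1)
    have e := hσ.stack_apply 0
    simp only [zero_add] at e
    rw [e] at hr hs'
    have := (hr.mono (show _ ≤ 14 * (M + T) + 3 by omega)).le_successProb _ hP good' 0 [] σ' rfl
    rw [successProb_nil] at this
    simpa only [hs', hg, if_true, hσ.qubits_eq] using this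
  have hlen := successProb_le_of_length_le (good := good)
    (good' := fun l => good' l ∧ l.length ≤ M + T) (zeroPad_nonneg hP) T M hn
    (fun l hl hg => ⟨hgood l hl hg, hl⟩) [A]
    (Memory.initial [unary ((k + K₀) ^ r + (k + 1)), unary (C * E), unary D])
    (length_stack_initial_le (by simp [unary]; omega))
  have hsim := successProb_le_simulate (P := zeroPad ((k + K₀) ^ r) P) hP hf
    (pad := padStack) (pre := List.replicate ((k + K₀) ^ r) false) (s₀ := s)
    (good := fun l => good' l ∧ l.length ≤ M + T) (good' := good')
    (fun F => by
      rw [sum_zeroPad_mul]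
      simp only [ofFn_append_false])
    (fun i s' hs' => runs_padStack (by omega) (by omega)
      ((hs' 6 (hmem 6 (by norm_num))).trans h6) ((hs' 3 (hmem 3 (by norm_num))).trans h3))
    hfinal T [A] (Memory.initial [unary ((k + K₀) ^ r + (k + 1)), unary (C * E), unary D])
    { Memory.initial [unary k, unary E, unary D] with stack := s }
    ⟨hs20, fun j _ => rfl, rfl, rfl⟩
  have hseq := hs.le_successProb P hP good'
    (T * (16 * (k + K₀) ^ r + 5) + (14 * (M + T) + 3) + 1)
    [.seq (A.simulate (· + 20) padStack) learnerFinish] _ rfl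
  exact (hlen.trans hsim).trans <| (successProb_seq_le hP good' _ _ _ _ le_rfl).trans
    (hseq.trans (successProb_seq_le hP good' _ _ _ _ (by omega)))

/-! ## The reduction -/

/-- The polynomial bound `(X + K₀) ^ r` for the number of padding zeros. -/
noncomputable def padPoly (K₀ r : ℕ) : Polynomial ℕ := (Polynomial.X + (K₀ : Polynomial ℕ)) ^ r

/-- A polynomial bound for the parameters of the simulated programs. -/
noncomputable def paramPoly (K₀ r C m₀ : ℕ) : Polynomial ℕ :=
  padPoly K₀ r + (Polynomial.X + 1) + (C : Polynomial ℕ) * Polynomial.X + Polynomial.X +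
    (Polynomial.X + (m₀ : Polynomial ℕ))

/-- A polynomial bound for the running times of the programs in the reduction. -/
noncomputable def timePoly (K₀ r C m₀ : ℕ) (p : Polynomial ℕ) : Polynomial ℕ :=
  let a := padPoly K₀ r
  let q := paramPoly K₀ r C m₀
  let T := p.comp q
  ((40 + 2 * C : ℕ) : Polynomial ℕ) * Polynomial.X + ((2 * K₀ + 4 * m₀ + 60 : ℕ) : Polynomial ℕ) +
    (r : Polynomial ℕ) * (30 * a + 4) + 9 * a + T * (16 * a + 5) + 60 * (q + T)

theorem polynomial_eval_mono (p : Polynomial ℕ) : Monotone fun n => p.eval n := by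
  intro a b h
  simp only [Polynomial.eval_eq_sum_range]
  exact Finset.sum_le_sum fun i _ => Nat.mul_le_mul_left _ (Nat.pow_le_pow_left h i)

theorem eval_padPoly (K₀ r N : ℕ) : (padPoly K₀ r).eval N = (N + K₀) ^ r := by
  simp [padPoly]

theorem eval_paramPoly (K₀ r C m₀ N : ℕ) : (paramPoly K₀ r C m₀).eval N =
    (N + K₀) ^ r + (N + 1) + C * N + N + (N + m₀) := by
  simp [paramPoly, eval_padPoly]

theorem eval_timePoly (K₀ r C m₀ N : ℕ) (p : Polynomial ℕ) : (timePoly K₀ r C m₀ p).eval N =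
    (40 + 2 * C) * N + (2 * K₀ + 4 * m₀ + 60) + r * (30 * (N + K₀) ^ r + 4) + 9 * (N + K₀) ^ r +
      p.eval ((paramPoly K₀ r C m₀).eval N) * (16 * (N + K₀) ^ r + 5) +
      60 * ((paramPoly K₀ r C m₀).eval N + p.eval ((paramPoly K₀ r C m₀).eval N)) := by
  simp [timePoly, eval_padPoly]

/-- A single number bounds sample length, scaled accuracy parameter, confidence parameter and
precision at once, so one value of `p` bounds all running times. -/
theorem le_eval_paramPoly (K₀ r C m₀ k E D : ℕ) : (k + K₀) ^ r + (k + 1) + C * E + D + (k + m₀) ≤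
    (paramPoly K₀ r C m₀).eval (k + E + D) := by
  have hZ : (k + K₀) ^ r ≤ (k + E + D + K₀) ^ r := Nat.pow_le_pow_left (by omega) r
  have hE : C * E ≤ C * (k + E + D) := Nat.mul_le_mul_left C (by omega)
  rw [eval_paramPoly]
  omega

theorem learner_time_le (K₀ r C m₀ : ℕ) (p : Polynomial ℕ) (k E D : ℕ) {T q : ℕ}
    (hq : q = (paramPoly K₀ r C m₀).eval (k + E + D)) (hT : T ≤ p.eval q) :
    (9 * k + 2 * K₀ + r * (30 * (k + K₀) ^ r + 4) + 9 * (k + K₀) ^ r + E * (2 * C + 5) +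
      7 * D + 20) + T * (16 * (k + K₀) ^ r + 5) + (14 * (q + T) + 3) + 2 ≤
    (timePoly K₀ r C m₀ p).eval (k + E + D) := by
  have hZ : (k + K₀) ^ r ≤ (k + E + D + K₀) ^ r := Nat.pow_le_pow_left (by omega) r
  have h1 : r * (30 * (k + K₀) ^ r + 4) ≤ r * (30 * (k + E + D + K₀) ^ r + 4) :=
    Nat.mul_le_mul_left r (by omega)
  have h2 : T * (16 * (k + K₀) ^ r + 5) ≤ p.eval q * (16 * (k + E + D + K₀) ^ r + 5) :=
    Nat.mul_le_mul hT (by omega)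
  have h3 : E * (2 * C + 5) ≤ (k + E + D) * (2 * C + 5) := Nat.mul_le_mul_right _ (by omega)
  rw [eval_timePoly, ← hq]
  linarith

/-- Reading `w`, the two runs and the comparison cost at most `33 q + 56 p(q)` plus setup terms,
which is where the factor 60 in `timePoly` comes from. -/
theorem hypothesis_time_le (K₀ r C m₀ : ℕ) (p : Polynomial ℕ) (k E D : ℕ) {q w o₀ o₁ : ℕ}
    (hq : q = (paramPoly K₀ r C m₀).eval (k + E + D)) (hw : w ≤ q + p.eval q)
    (ho₀ : o₀ ≤ q + p.eval q + p.eval q) (ho₁ : o₁ ≤ q + p.eval q + p.eval q) :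
    (22 * k + 16 * w + 2 * K₀ + 4 * m₀ + r * (30 * (k + K₀) ^ r + 4) + 9 * (k + K₀) ^ r + 20) +
      6 * p.eval q + (10 * o₀ + 7 * o₁ + 5) + 3 ≤ (timePoly K₀ r C m₀ p).eval (k + E + D) := by
  have hZ : (k + K₀) ^ r ≤ (k + E + D + K₀) ^ r := Nat.pow_le_pow_left (by omega) r
  have h1 : r * (30 * (k + K₀) ^ r + 4) ≤ r * (30 * (k + E + D + K₀) ^ r + 4) :=
    Nat.mul_le_mul_left r (by omega)
  have h2 : p.eval q * 5 ≤ p.eval q * (16 * (k + E + D + K₀) ^ r + 5) :=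
    Nat.mul_le_mul_left _ (by omega)
  have h3 : 0 ≤ C * (k + E + D) := Nat.zero_le _
  rw [eval_timePoly, ← hq]
  linarith

/-- The approximate values of an evaluator at the points `0 ⋯ 0 x b`. -/
theorem IsEvaluator.exists_output {V : Program} (hV : V.IsDeterministic) {w : List Bool} {t : ℕ → ℕ}
    {Z k : ℕ} {Q : Bits (Z + (k + 1)) → ℝ} (h : IsEvaluator V w t Q) (x : Bits k) (b : Bool)
    {m T M : ℕ} (hT : t m ≤ T) (hw : w.length ≤ M) (hn : Z + (k + 1) ≤ M) (hm : m ≤ M) :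
    ∃ out : List Bool,
      |(binaryValue out : ℝ) / 2 ^ m -
        Q (Fin.append (fun _ => false) (Fin.snoc x b : Bits (k + 1)))| ≤ 1 / 2 ^ m ∧
      out.length ≤ M + T ∧
      ∀ {n : ℕ} (P : Bits n → ℝ) (σ : Memory), σ.stack = (Memory.initial
        [w, List.replicate Z false ++ (List.ofFn x ++ [b]), unary m]).stack →
        successProb P (· = out) T [V] σ = σ.qubits.normSq := by
  have hx : List.ofFn (Fin.append (fun _ : Fin Z => false) (Fin.snoc x b : Bits (k + 1))) =
      List.replicate Z false ++ (List.ofFn x ++ [b]) := by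
    rw [ofFn_append_false, List.ofFn_succ', List.concat_eq_append]
    simp
  have hout := h (Fin.append (fun _ => false) (Fin.snoc x b : Bits (k + 1))) m
  rw [hx] at hout
  have hout' : Outputs V [w, List.replicate Z false ++ (List.ofFn x ++ [b]), unary m] T
      fun out => |(binaryValue out : ℝ) / 2 ^ m -
        Q (Fin.append (fun _ => false) (Fin.snoc x b : Bits (k + 1)))| ≤ 1 / 2 ^ m :=
    le_antisymm (runProb_le_one hV _ _ _ _)
      (hout.symm.le.trans (successProb_mono (fun _ => zero_le_one) _ _ _ hT))
  exact hout'.exists_eq hV (by simp [unary]; omega)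

/-- A learner for classes of distributions that contain the padded noisy parities, where `k`-bit
parities are padded with `(k + K₀) ^ r` zeros, yields a learner for noisy parities. -/
theorem noisyParityLearnable_of_evaluatorLearnable {M : Model} {η : ℝ} (h0 : 0 < η) (h1 : η < 1 / 2)
    {K₀ : ℕ} (hK₀ : 1 ≤ K₀) (r : ℕ) {D : (n : ℕ) → Set (Bits n → ℝ)}
    (hD : ∀ k (s : Bits k),
      zeroPad ((k + K₀) ^ r) (noisyParity η s) ∈ D ((k + K₀) ^ r + (k + 1)))
    (hL : EvaluatorLearnable M D) : NoisyParityLearnable M η := by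
  obtain ⟨A, V, p, hA, hV, hlearn⟩ := hL
  have hgap : 0 < 1 - 2 * η := by linarith
  -- The weights are of order `1 / 2 ^ k`, so the precision is `k` plus a constant `m₀`, chosen to
  -- make the rounding loss `2 / 2 ^ m₀` less than half of the gap `1 - 2η`.
  obtain ⟨m₀, hm₀⟩ := pow_unbounded_of_one_lt (4 / (1 - 2 * η)) (one_lt_two (α := ℝ))
  set C : ℕ := 2 ^ m₀ with hC
  have hCgap : 4 < (1 - 2 * η) * C := by
    rw [div_lt_iff₀ hgap] at hm₀
    rw [hC]; push_cast; linarith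
  have hC4 : (4 : ℝ) < C := by nlinarith
  refine ⟨learnerProgram K₀ r C A, hypothesisProgram K₀ r m₀ V, timePoly K₀ r C m₀ p,
    admits_learnerProgram K₀ r C hA, isDeterministic_hypothesisProgram K₀ r m₀ hV, ?_⟩
  intro k s ε δ hε hε1 hδ hδ1
  set E := ⌈1 / ε⌉₊ with hE
  set Δ := ⌈1 / δ⌉₊
  set Z := (k + K₀) ^ r
  obtain ⟨q, hq⟩ : ∃ q, q = (paramPoly K₀ r C m₀).eval (k + E + Δ) := ⟨_, rfl⟩
  have hqle : Z + (k + 1) + C * E + Δ + (k + m₀) ≤ q := by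
    rw [hq]; exact le_eval_paramPoly K₀ r C m₀ k E Δ
  have hEpos : 0 < E := Nat.ceil_pos.2 (by positivity)
  have hEε : 1 / (E : ℝ) ≤ ε := by
    rw [div_le_iff₀ (by positivity), ← div_le_iff₀' hε]
    exact Nat.le_ceil _
  have hCE : (4 : ℝ) < C * E := by
    have : (1 : ℝ) ≤ E := by exact_mod_cast hEpos
    nlinarith
  have hceil : ⌈1 / (1 / ((C : ℝ) * E))⌉₊ = C * E := by
    rw [one_div_one_div, ← Nat.cast_mul, Nat.ceil_natCast]
  -- The accuracy is the reciprocal of an integer, so its unary encoding is exactly `C * E`, which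
  -- the setup can compute.
  have hrun := hlearn (Z + (k + 1)) _ (hD k s) (1 / (C * E)) δ (by positivity)
    (by rw [div_lt_one (by linarith)]; linarith) hδ hδ1
  rw [hceil] at hrun
  have hT : p.eval (Z + (k + 1) + C * E + Δ) ≤ p.eval q := polynomial_eval_mono p (by omega)
  refine hrun.trans (runProb_le_learnerProgram hK₀ r C A (M := q)
    (noisyParity_nonneg h0.le (by linarith) s) (by omega) (by omega) (by omega) ?_
    (learner_time_le K₀ r C m₀ p k E Δ hq hT))
  rintro w hw ⟨Q, hQ, htv, heval⟩
  have hw' : w.length ≤ q + p.eval q := hw.trans (Nat.add_le_add_left hT q)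
  choose o ho holen horun using fun (x : Bits k) (b : Bool) =>
    heval.exists_output hV x b (m := k + m₀) (T := p.eval q) (M := q + p.eval q)
      (polynomial_eval_mono p (by omega)) hw' (by omega) (by omega)
  refine ⟨fun x => decide (binaryValue (o x false) < binaryValue (o x true)), ?_, fun x => ?_⟩
  · have hcard := card_ne_parity_le (Z := Z) (m₀ := m₀) (η := η) (s := s) (Q := Q)
      (v := fun x b => (binaryValue (o x b) : ℝ) / 2 ^ (k + m₀)) ho
      (h := fun x => decide (binaryValue (o x false) < binaryValue (o x true)))
      (fun x => by
        rw [decide_eq_decide, div_lt_div_iff_of_pos_right (by positivity), Nat.cast_lt])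
    refine lt_of_lt_of_le ?_ hEε
    have ha : (0 : ℝ) ≤ ((Finset.univ.filter fun x => decide (binaryValue (o x false) <
      binaryValue (o x true)) ≠ parity s x).card : ℝ) / 2 ^ k := by positivity
    generalize ((Finset.univ.filter fun x => decide (binaryValue (o x false) <
      binaryValue (o x true)) ≠ parity s x).card : ℝ) / 2 ^ k = a at hcard ha ⊢
    have hgap' : 4 / (C : ℝ) ≤ 1 - 2 * η := by
      rw [div_le_iff₀ (by linarith)]; exact hCgap.le
    have hCm : (2 : ℝ) / 2 ^ m₀ = (4 / C) / 2 := by rw [hC]; push_cast; ring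
    rw [hCm] at hcard
    -- The remaining gap is at least `2 / C` and twice the distance is below `2 / (C E)`, so the
    -- error `a` is below `1 / E ≤ ε`.
    have h2 : a * ((4 / C) / 2) < 2 * (1 / (C * E)) := by
      have := mul_le_mul_of_nonneg_left (show 4 / (C : ℝ) / 2 ≤ 1 - 2 * η - 4 / C / 2 by linarith) ha
      linarith
    have hCpos : (0 : ℝ) < C := by linarith
    have hEpos' : (0 : ℝ) < E := by exact_mod_cast hEpos
    rw [lt_div_iff₀ hEpos']
    have h3 : 2 * (a * E) / (C * E) < 2 * 1 / (C * E) := by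
      convert h2 using 1
      · field_simp; ring
      · ring
    rw [div_lt_div_iff_of_pos_right (by positivity)] at h3
    linarith
  · have hlen : (List.ofFn x).length = k := List.length_ofFn
    refine outputs_hypothesisProgram hK₀ r m₀ hV (T := p.eval q) ?_ ?_ ?_ (o₀ := o x false)
      (o₁ := o x true)
    · rw [hlen]; exact horun x false
    · rw [hlen]; exact horun x true
    · rw [hlen]
      exact hypothesis_time_le K₀ r C m₀ p k E Δ hq hw' (holen x false) (holen x true)

end CircuitLearning

theorem mainTheorem5 (M : CircuitLearning.Model)
    (η : ℝ) (hη_pos : 0 < η) (hη_lt : η < 1 / 2)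
    (hLPN : CircuitLearning.LPNAssumption M η)
    (d : ℕ → ℕ)
    (hd : ∃ c : ℝ, 0 < c ∧ ∀ᶠ n : ℕ in Filter.atTop, (n : ℝ) ^ c ≤ (d n : ℝ)) :
    ¬ CircuitLearning.EvaluatorLearnable M
      (fun n => CircuitLearning.circuitDistributions n (d n)) := by
  obtain ⟨c, hc, hd⟩ := hd
  obtain ⟨N₀, hN₀⟩ := Filter.eventually_atTop.1 hd
  have hr : ⌈1 / c⌉₊ ≠ 0 := (Nat.ceil_pos.2 (by positivity)).ne'
  -- The shift `N₀ + 1` makes the base positive and puts every padded length in the range where the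
  -- bound on `d` holds; the exponent `⌈1 / c⌉` compensates the power `c`.
  refine fun hL => hLPN (CircuitLearning.noisyParityLearnable_of_evaluatorLearnable hη_pos hη_lt
    (K₀ := N₀ + 1) (by omega) ⌈1 / c⌉₊ (fun k s => ?_) hL)
  refine CircuitLearning.zeroPad_noisyParity_mem_circuitDistributions hη_pos.le (by linarith) s _ ?_
  set n := (k + (N₀ + 1)) ^ ⌈1 / c⌉₊ + (k + 1) with hn
  have hpow : k + (N₀ + 1) ≤ (k + (N₀ + 1)) ^ ⌈1 / c⌉₊ := Nat.le_self_pow hr _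
  -- The base is at least 1 and `⌈1 / c⌉ * c ≥ 1`, so the `c`-th power of the number of zeros alone
  -- already reaches `k + N₀ + 1`.
  have h1 : ((k + (N₀ + 1) : ℕ) : ℝ) ≤ (n : ℝ) ^ c := by
    calc ((k + (N₀ + 1) : ℕ) : ℝ) = ((k + (N₀ + 1) : ℕ) : ℝ) ^ (1 : ℝ) := (Real.rpow_one _).symm
      _ ≤ ((k + (N₀ + 1) : ℕ) : ℝ) ^ ((⌈1 / c⌉₊ : ℝ) * c) := by
        refine Real.rpow_le_rpow_of_exponent_le (by exact_mod_cast (by omega)) ?_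
        rw [← div_le_iff₀ hc]
        exact Nat.le_ceil _
      _ = (((k + (N₀ + 1)) ^ ⌈1 / c⌉₊ : ℕ) : ℝ) ^ c := by
        rw [Real.rpow_mul (by positivity), Real.rpow_natCast, Nat.cast_pow]
      _ ≤ (n : ℝ) ^ c :=
        Real.rpow_le_rpow (by positivity) (by exact_mod_cast (by omega)) hc.le
  have h2 := h1.trans (hN₀ n (by omega))
  have h3 : k + (N₀ + 1) ≤ d n := by exact_mod_cast h2
  omega
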